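/- Let $(X(k))_{k\ge 1}$ be a sequence of independent standard complex Gaussians (so the real and imaginary parts of each $X(k)$ are independent real Gaussians with mean $0$ and variance $\tfrac12$), and for real $K\ge 1$ put $$F_K(z)=\exp\Big(\sum_{1\le k\le K}\frac{X(k)}{\sqrt k}\,z^k\Big).$$ For real $K\ge 10$ and $e^{-1/40}\le r<1$, define $K_r>0$ by letting $\log K_r$ be the largest integer such that $K_r\le\min\{\frac{-1}{4\log r},\,K\}$. Then there is an absolute constant $C>0$ such that for all real $K\ge 10$, all $\tfrac12\le q\le 1$ and all $e^{-1/40}\le r<1$, $$\mathbb{E}\Big[\Big(\int_0^{2\pi}|F_K(re^{i\theta})|^2\,d\theta\Big)^q\Big]\ \ge\ C\,\Big(\frac{K_r}{(1-q)\sqrt{\log K_r}+1}\Big)^q .$$ -/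

import Mathlib

open MeasureTheory ProbabilityTheory

noncomputable section

namespace HarperModel

/-- The law of a standard complex Gaussian: the real and imaginary parts are independent real
Gaussians with mean `0` and variance `1/2`. -/
def stdComplexGaussian : Measure ℂ :=
  ((gaussianReal 0 (1 / 2)).prod (gaussianReal 0 (1 / 2))).map
    Complex.measurableEquivRealProd.symm

instance : IsProbabilityMeasure stdComplexGaussian :=
  Measure.isProbabilityMeasure_map Complex.measurableEquivRealProd.symm.measurable.aemeasurable

/-- `X 1, X 2, X 3, …` is a sequence of independent standard complex Gaussians on the
probability space `(Ω, P)`. Nothing is asked of the unused entry `X 0`. -/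
structure IsStdComplexGaussianSeq {Ω : Type*} [MeasurableSpace Ω] (P : Measure Ω)
    (X : ℕ → Ω → ℂ) : Prop where
  indep : iIndepFun (fun k : ℕ => X (k + 1)) P
  law : ∀ k : ℕ, 1 ≤ k → HasLaw (X k) stdComplexGaussian P

/-- The random function `F_K(z) = exp (∑_{1 ≤ k ≤ K} X(k) z^k / √k)` for a real number `K`,
at the sample point `ω`. -/
def F {Ω : Type*} (X : ℕ → Ω → ℂ) (K : ℝ) (ω : Ω) (z : ℂ) : ℂ :=
  Complex.exp (∑ k ∈ Finset.Icc 1 ⌊K⌋₊, X k ω / (Real.sqrt (k : ℝ) : ℂ) * z ^ k)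

/-- `log K_r`: the largest integer `n` with `e ^ n ≤ min (-1 / (4 log r)) K`
(see `isGreatest_logKr`). -/
def logKr (K r : ℝ) : ℤ :=
  ⌊Real.log (min (-1 / (4 * Real.log r)) K)⌋

/-- `K_r = e ^ (log K_r)`. -/
def Kr (K r : ℝ) : ℝ :=
  Real.exp (logKr K r)

theorem isGreatest_logKr {K r : ℝ} (hK : 0 < K) (hr0 : 0 < r) (hr1 : r < 1) :
    IsGreatest {n : ℤ | Real.exp n ≤ min (-1 / (4 * Real.log r)) K} (logKr K r) := by
  have hlog : Real.log r < 0 := Real.log_neg hr0 hr1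
  have hm : 0 < min (-1 / (4 * Real.log r)) K :=
    lt_min (div_pos_of_neg_of_neg (by norm_num) (by linarith)) hK
  constructor
  · exact (Real.le_log_iff_exp_le hm).1 (Int.floor_le _)
  · intro n hn
    exact Int.le_floor.2 ((Real.le_log_iff_exp_le hm).2 hn)

end HarperModel

end

namespace HarperModel

open scoped ENNReal NNReal

/-! ### One-dimensional Gaussian estimates -/

/-! The integral of `|F|²` is the total mass of a critical Gaussian multiplicative chaos, and the
proof bounds its moments from below by a barrier and the first two moments. Up to index `2 ^ N ≍
K_r` the damping by powers of `r` is harmless. The dyadic blocks of the exponent are then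
independent Gaussian steps with variances in `[1/8, 1/2]`, and `E |F|² ≍ 2 ^ N`. Weighting by the
normalized `|F|²` shifts each step by exactly its compensator, so the distance `pos` to the barrier
is a centred walk started at `a`. Let `mass` collect the weight of those angles at which this walk
stays positive and ends above `√N`.

First moment (`le_lintegral_mass`): a centred walk from `a` survives `N` steps and ends above `√N`
with probability at least of order `a / √N`. Reflection survives discretization as the one-sided
inequality `reflectGap_le_kill`.

Second moment (`lintegral_sq_mass_le`): `mass` is at most `derivMass / √N`, and `derivMass` has
second moment `O(exp (2a))`. For two angles at distance about `2 ^ (-m)`, the first `m` blocks are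
treated as equal. The later ones are nearly independent, because their covariances decay
geometrically (`twoPoint_le_of_scale`). Integrating over the angles cancels `2 ^ m` and leaves `∑
E[exp (-pos)]` over the killed walk, which is bounded (`sum_killIter_exp_le`). Superharmonicity of
`y + 3` and `4 - exp (-y)` for the killed walk drives both halves.

With `t = a / √N`, Hölder between the orders `q`, `1`, `2` gives `E mass ^ q ≥ c t ^ q exp (-2a(1 -
q))`. Choosing `a` comparable to `min (√N, 1 / (1 - q))` produces the stated denominator. Indices
beyond `2 ^ N` are restored by a sign symmetry (`lintegral_circleMass_rpow_mono`). -/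

theorem lintegral_gaussianReal_neg (v : ℝ≥0) (f : ℝ → ℝ≥0∞) (hf : Measurable f) :
    ∫⁻ g, f (-g) ∂gaussianReal 0 v = ∫⁻ g, f g ∂gaussianReal 0 v := by
  have h := gaussianReal_map_neg (μ := 0) (v := v)
  rw [neg_zero] at h
  conv_rhs => rw [← h]
  rw [lintegral_map hf (by fun_prop)]

theorem integral_gaussianReal_neg (v : ℝ≥0) (f : ℝ → ℝ) :
    ∫ g, f (-g) ∂gaussianReal 0 v = ∫ g, f g ∂gaussianReal 0 v := by
  have h := gaussianReal_map_neg (μ := 0) (v := v)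
  rw [neg_zero] at h
  conv_rhs => rw [← h]
  exact ((MeasurableEquiv.neg ℝ).measurableEmbedding.integral_map f).symm

/-- Cameron-Martin formula in dimension one. -/
theorem lintegral_exp_mul_gaussianReal (v : ℝ≥0) (t : ℝ) (f : ℝ → ℝ≥0∞) (hf : Measurable f) :
    ∫⁻ g, ENNReal.ofReal (Real.exp (t * g)) * f g ∂gaussianReal 0 v =
      ENNReal.ofReal (Real.exp (t ^ 2 * v / 2)) * ∫⁻ g, f (g + t * v) ∂gaussianReal 0 v := by
  rcases eq_or_ne v 0 with rfl | hv
  · simp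
  have h := gaussianReal_map_add_const (μ := 0) (v := v) (t * v)
  rw [zero_add] at h
  have h2 : ∫⁻ g, f (g + t * v) ∂gaussianReal 0 v = ∫⁻ g, f g ∂gaussianReal (t * v) v := by
    rw [← h, lintegral_map hf (by fun_prop)]
  have hv' : (v : ℝ) ≠ 0 := by exact_mod_cast hv
  rw [h2, gaussianReal_of_var_ne_zero _ hv, gaussianReal_of_var_ne_zero _ hv,
    lintegral_withDensity_eq_lintegral_mul _ (measurable_gaussianPDF _ _) (by fun_prop),
    lintegral_withDensity_eq_lintegral_mul _ (measurable_gaussianPDF _ _) hf,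
    ← lintegral_const_mul _ ((measurable_gaussianPDF _ _).mul hf)]
  congr 1 with g
  simp only [Pi.mul_apply, gaussianPDF, gaussianPDFReal]
  rw [← mul_assoc, ← mul_assoc, ← ENNReal.ofReal_mul (by positivity),
    ← ENNReal.ofReal_mul (by positivity)]
  congr 2
  rw [mul_assoc, mul_left_comm (Real.exp (t ^ 2 * v / 2)), ← Real.exp_add, ← Real.exp_add]
  congr 2
  field_simp
  ring

/-- The exponential factor of the density increases with the variance, so only the normalizing
constants cost anything. This later lets two unequal variances be replaced by a common one. -/
theorem gaussianReal_le_smul {s s' : ℝ≥0} (hs : 0 < s) (hss : s ≤ s') :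
    gaussianReal 0 s ≤ ENNReal.ofReal (Real.sqrt (s' / s)) • gaussianReal 0 s' := by
  have hs' : 0 < s' := hs.trans_le hss
  have h1 : (0 : ℝ) < s := by exact_mod_cast hs
  have h2 : (0 : ℝ) < s' := by exact_mod_cast hs'
  have h3 : (s : ℝ) ≤ s' := by exact_mod_cast hss
  rw [gaussianReal_of_var_ne_zero _ hs.ne', gaussianReal_of_var_ne_zero _ hs'.ne',
    ← withDensity_smul _ (measurable_gaussianPDF _ _)]
  refine withDensity_mono (ae_of_all _ fun g => ?_)
  simp only [Pi.smul_apply, smul_eq_mul, gaussianPDF, gaussianPDFReal]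
  rw [← ENNReal.ofReal_mul (by positivity)]
  refine ENNReal.ofReal_le_ofReal ?_
  rw [← mul_assoc]
  refine mul_le_mul (le_of_eq ?_) (Real.exp_le_exp.2 ?_) (by positivity) (by positivity)
  · rw [Real.sqrt_div h2.le, Real.sqrt_mul (by positivity : 0 ≤ 2 * Real.pi) s,
      Real.sqrt_mul (by positivity : 0 ≤ 2 * Real.pi) s']
    have := Real.sqrt_pos.2 h1
    have := Real.sqrt_pos.2 h2
    have : 0 < Real.sqrt (2 * Real.pi) := by positivity
    field_simp
  · rw [neg_div, neg_div, neg_le_neg_iff]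
    gcongr

theorem integrable_exp_neg_gaussianReal (v : ℝ≥0) (x : ℝ) :
    Integrable (fun g => Real.exp (-(x + g))) (gaussianReal 0 v) := by
  have := (integrable_exp_mul_gaussianReal (μ := 0) (v := v) (-1)).const_mul (Real.exp (-x))
  refine this.congr (ae_of_all _ fun g => ?_)
  simp only [← Real.exp_add]
  ring_nf

theorem integral_exp_neg_gaussianReal (v : ℝ≥0) (x : ℝ) :
    ∫ g, Real.exp (-(x + g)) ∂gaussianReal 0 v = Real.exp (v / 2) * Real.exp (-x) := by
  have h := congrFun (mgf_fun_id_gaussianReal (μ := 0) (v := v)) (-1)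
  simp only [mgf] at h
  have : ∀ g : ℝ, Real.exp (-(x + g)) = Real.exp (-x) * Real.exp (-1 * g) := fun g => by
    rw [← Real.exp_add]; ring_nf
  simp_rw [this, integral_const_mul, h]
  rw [mul_comm]
  congr 2
  ring

theorem integrable_id_gaussianReal (v : ℝ≥0) : Integrable (fun g : ℝ => g) (gaussianReal 0 v) :=
  memLp_one_iff_integrable.1 (memLp_id_gaussianReal 1)

theorem exp_half_le_two : Real.exp (1 / 2) ≤ 2 := by
  have h : Real.exp (1 / 2) ^ 2 ≤ 2 ^ 2 := by
    rw [← Real.exp_nat_mul]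
    have := Real.exp_one_lt_d9
    norm_num
    linarith
  exact (abs_le_of_sq_le_sq' h (by norm_num)).2

/-- The expectation of `4 - exp (overshoot)` on the event that a Gaussian walk at height `x ≥ 0`
steps out of the half line is nonnegative. -/
theorem integral_overshoot_nonneg {v : ℝ≥0} (hv : 0 < v) (hv1 : v ≤ 1) {x : ℝ} (hx : 0 ≤ x) :
    0 ≤ ∫ g, (Set.Iic 0).indicator (fun y => 4 - Real.exp (-y)) (x + g) ∂gaussianReal 0 v := by
  set ψ : ℝ → ℝ := (Set.Iic 0).indicator (fun y => 4 - Real.exp (-y)) with hψ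
  have hψm : Measurable ψ := by
    apply Measurable.indicator (by fun_prop) measurableSet_Iic
  have hvr : (0 : ℝ) < v := by exact_mod_cast hv
  have hint : ∀ x, Integrable (fun g => ψ (x + g)) (gaussianReal 0 v) := by
    intro x
    have h1 : Integrable (fun g => 4 - Real.exp (-(x + g))) (gaussianReal 0 v) :=
      (integrable_const _).sub (integrable_exp_neg_gaussianReal v x)
    refine h1.mono (hψm.comp (by fun_prop)).aestronglyMeasurable (ae_of_all _ fun g => ?_)
    simp only [hψ]
    exact norm_indicator_le_norm_self (fun y => 4 - Real.exp (-y)) (x + g)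
  have hint' : ∀ x, Integrable ψ (gaussianReal x v) := by
    intro x
    have h := gaussianReal_map_const_add (μ := 0) (v := v) x
    rw [zero_add] at h
    rw [← h, integrable_map_measure hψm.aestronglyMeasurable (by fun_prop)]
    exact hint x
  have hmap : ∫ g, ψ (x + g) ∂gaussianReal 0 v = ∫ g, ψ g ∂gaussianReal x v := by
    have h := gaussianReal_map_const_add (μ := 0) (v := v) x
    rw [zero_add] at h
    rw [← h, integral_map (by fun_prop) hψm.aestronglyMeasurable]
  -- Start at the barrier itself: pairing `g` with `-g` bounds the sum of the two values below by `4
  -- - exp (-g) - exp g`, of mean `4 - 2 exp (v / 2) ≥ 0`.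
  have h0 : 0 ≤ ∫ g, ψ g ∂gaussianReal 0 v := by
    have e1 : ∫ g, ψ g ∂gaussianReal 0 v + ∫ g, ψ (-g) ∂gaussianReal 0 v
        = 2 * ∫ g, ψ g ∂gaussianReal 0 v := by
      rw [integral_gaussianReal_neg]; ring
    have i1 : Integrable ψ (gaussianReal 0 v) := hint' 0
    have i2 : Integrable (fun g => ψ (-g)) (gaussianReal 0 v) := by
      have h := gaussianReal_map_neg (μ := 0) (v := v)
      rw [neg_zero] at h
      rw [← h] at i1
      exact i1.comp_measurable (by fun_prop)
    have i3 := integrable_exp_neg_gaussianReal v 0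
    simp only [zero_add] at i3
    have i4 : Integrable (fun g => Real.exp g) (gaussianReal 0 v) := by
      simpa using integrable_exp_mul_gaussianReal (μ := 0) (v := v) 1
    have e2 : ∫ g, (4 - Real.exp (-g) - Real.exp g) ∂gaussianReal 0 v ≤
        ∫ g, ψ g ∂gaussianReal 0 v + ∫ g, ψ (-g) ∂gaussianReal 0 v := by
      rw [← integral_add i1 i2]
      refine integral_mono (((integrable_const _).sub i3).sub i4) (i1.add i2) fun g => ?_
      simp only [hψ, Set.indicator, Set.mem_Iic]
      have := Real.exp_pos g
      have := Real.exp_pos (-g)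
      split_ifs with h1 h2 h2
      · have : g = 0 := by linarith
        subst this; norm_num
      · linarith
      · rw [neg_neg]; linarith
      · linarith
    have e3 := integral_exp_neg_gaussianReal v 0
    simp only [zero_add, neg_zero, Real.exp_zero, mul_one] at e3
    have e4 : ∫ g, Real.exp g ∂gaussianReal 0 v = Real.exp (v / 2) := by
      rw [← e3, integral_gaussianReal_neg v Real.exp]
    have i5 : Integrable (fun g => 4 - Real.exp (-g)) (gaussianReal 0 v) :=
      (integrable_const _).sub i3
    rw [integral_sub i5 i4, integral_sub (integrable_const _) i3, e3,
      e4] at e2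
    simp only [integral_const, probReal_univ, smul_eq_mul, one_mul] at e2
    have : Real.exp (v / 2) ≤ Real.exp (1 / 2) := by
      apply Real.exp_le_exp.2
      have : (v : ℝ) ≤ 1 := by exact_mod_cast hv1
      linarith
    linarith [exp_half_le_two]
  rw [hmap, integral_gaussianReal_eq_integral_smul hv.ne']
  -- Moving the mean from `0` to `x` multiplies the density by a constant times `exp (x * y / v)`,
  -- which increases in `y`. On `y ≤ 0`, `ψ` passes from negative to positive at `y = -log 4`, so
  -- freezing that factor at its value there only lowers the product.
  have hk : ∀ y, Real.exp (-x ^ 2 / (2 * v)) * Real.exp (-(x * Real.log 4) / v) *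
      (gaussianPDFReal 0 v y • ψ y) ≤ gaussianPDFReal x v y • ψ y := by
    intro y
    by_cases hy : y ≤ 0
    · have hψy : ψ y = 4 - Real.exp (-y) := Set.indicator_of_mem (by exact hy) _
      have hpdf : gaussianPDFReal x v y =
          gaussianPDFReal 0 v y * (Real.exp (-x ^ 2 / (2 * v)) * Real.exp (x * y / v)) := by
        simp only [gaussianPDFReal]
        rw [← Real.exp_add, mul_assoc (Real.sqrt _)⁻¹, ← Real.exp_add]
        congr 2
        field_simp
        ring
      rw [hpdf, hψy, smul_eq_mul, smul_eq_mul]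
      have hp := gaussianPDFReal_nonneg 0 v y
      have key : Real.exp (-(x * Real.log 4) / v) * (4 - Real.exp (-y)) ≤
          Real.exp (x * y / v) * (4 - Real.exp (-y)) := by
        rcases le_total (Real.exp (-y)) 4 with h | h
        · have : -y ≤ Real.log 4 := (Real.le_log_iff_exp_le (by norm_num)).2 h
          refine mul_le_mul_of_nonneg_right (Real.exp_le_exp.2 ?_) (by linarith)
          gcongr
          nlinarith
        · have : Real.log 4 ≤ -y := (Real.log_le_iff_le_exp (by norm_num)).2 h
          refine mul_le_mul_of_nonpos_right (Real.exp_le_exp.2 ?_) (by linarith)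
          gcongr
          nlinarith
      have hc : 0 ≤ gaussianPDFReal 0 v y * Real.exp (-x ^ 2 / (2 * v)) := by positivity
      nlinarith [mul_le_mul_of_nonneg_left key hc]
    · have : ψ y = 0 := Set.indicator_of_notMem (by simpa using hy) _
      simp [this]
  have hi : ∀ m, Integrable (fun y => gaussianPDFReal m v y • ψ y) := by
    intro m
    have := hint' m
    rw [gaussianReal_of_var_ne_zero _ hv.ne', integrable_withDensity_iff_integrable_smul'
      (measurable_gaussianPDF _ _) (ae_of_all _ fun _ => gaussianPDF_lt_top)] at this
    simpa [toReal_gaussianPDF] using this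
  rw [integral_gaussianReal_eq_integral_smul hv.ne'] at h0
  calc 0 ≤ Real.exp (-x ^ 2 / (2 * v)) * Real.exp (-(x * Real.log 4) / v) *
      ∫ y, gaussianPDFReal 0 v y • ψ y := by positivity
    _ = _ := (integral_const_mul _ _).symm
    _ ≤ _ := integral_mono ((hi 0).const_mul _) (hi x) hk

/-! ### Superharmonic functions of the walk killed on leaving the half line. -/

/-- Transition operator of a centred Gaussian walk of variance `v` killed outside `(0, ∞)`. -/
noncomputable def kill (v : ℝ≥0) (f : ℝ → ℝ≥0∞) (x : ℝ) : ℝ≥0∞ :=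
  ∫⁻ g, (Set.Ioi 0).indicator f (x + g) ∂gaussianReal 0 v

theorem measurable_indicator_Ioi {f : ℝ → ℝ≥0∞} (hf : Measurable f) :
    Measurable ((Set.Ioi (0 : ℝ)).indicator f) :=
  hf.indicator measurableSet_Ioi

theorem measurable_kill (v : ℝ≥0) {f : ℝ → ℝ≥0∞} (hf : Measurable f) : Measurable (kill v f) := by
  have := measurable_indicator_Ioi hf
  unfold kill
  exact Measurable.lintegral_prod_right' (f := fun p : ℝ × ℝ =>
    (Set.Ioi (0 : ℝ)).indicator f (p.1 + p.2)) (by fun_prop)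

/-- The free mean splits according to the side of `0` on which the step lands. If the part that is
discarded has nonnegative integral, the killed mean is at most the free one; `f` itself may be
negative below the barrier. -/
theorem kill_ofReal_le {v : ℝ≥0} {f : ℝ → ℝ} (hf : Measurable f) {x b : ℝ}
    (hpos : ∀ y, 0 < y → 0 ≤ f y)
    (hi : Integrable (fun g => f (x + g)) (gaussianReal 0 v))
    (h0 : 0 ≤ ∫ g, (Set.Iic 0).indicator f (x + g) ∂gaussianReal 0 v)
    (hb : ∫ g, f (x + g) ∂gaussianReal 0 v ≤ b) :
    kill v (fun y => ENNReal.ofReal (f y)) x ≤ ENNReal.ofReal b := by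
  have him : ∀ s : Set ℝ, MeasurableSet s →
      Integrable (fun g => s.indicator f (x + g)) (gaussianReal 0 v) := fun s hs =>
    hi.mono ((hf.indicator hs).comp (by fun_prop)).aestronglyMeasurable
      (ae_of_all _ fun g => norm_indicator_le_norm_self f (x + g))
  have e : kill v (fun y => ENNReal.ofReal (f y)) x =
      ∫⁻ g, ENNReal.ofReal ((Set.Ioi 0).indicator f (x + g)) ∂gaussianReal 0 v := by
    unfold kill
    congr 1 with g
    simp only [Set.indicator]
    split_ifs <;> simp
  rw [e, ← ofReal_integral_eq_lintegral_ofReal (him _ measurableSet_Ioi)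
    (ae_of_all _ fun g => Set.indicator_nonneg (fun y hy => hpos y hy) _)]
  refine ENNReal.ofReal_le_ofReal (le_trans ?_ hb)
  have : ∫ g, f (x + g) ∂gaussianReal 0 v =
      ∫ g, (Set.Ioi 0).indicator f (x + g) ∂gaussianReal 0 v +
      ∫ g, (Set.Iic 0).indicator f (x + g) ∂gaussianReal 0 v := by
    rw [← integral_add (him _ measurableSet_Ioi) (him _ measurableSet_Iic)]
    congr 1 with g
    by_cases h : 0 < x + g
    · simp [Set.indicator, h, not_le.2 h]
    · simp [Set.indicator, h, not_lt.1 h]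
  linarith

/-- Affine functions are preserved by a free centred step. The exit part is nonnegative because `y +
3 ≥ 4 - exp (-y)`, which reduces it to `integral_overshoot_nonneg`. -/
theorem kill_affine_le {v : ℝ≥0} (hv : 0 < v) (hv1 : v ≤ 1) {x : ℝ} (hx : 0 ≤ x) :
    kill v (fun y => ENNReal.ofReal (y + 3)) x ≤ ENNReal.ofReal (x + 3) := by
  have hi : Integrable (fun g => x + g + 3) (gaussianReal 0 v) :=
    ((integrable_const x).add (integrable_id_gaussianReal v)).add (integrable_const _)
  have hi2 : Integrable (fun g => 4 - Real.exp (-(x + g))) (gaussianReal 0 v) :=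
    (integrable_const _).sub (integrable_exp_neg_gaussianReal v x)
  refine kill_ofReal_le (by fun_prop) (fun y hy => by linarith) hi ?_ (le_of_eq ?_)
  · refine (integral_overshoot_nonneg hv hv1 hx).trans (integral_mono ?_ ?_ fun g => ?_)
    · refine hi2.mono (Measurable.aestronglyMeasurable ?_)
        (ae_of_all _ fun g =>
          norm_indicator_le_norm_self (fun y => 4 - Real.exp (-y)) (x + g))
      exact (Measurable.indicator (by fun_prop) measurableSet_Iic).comp (by fun_prop)
    · refine hi.mono (Measurable.aestronglyMeasurable ?_)
        (ae_of_all _ fun g => norm_indicator_le_norm_self (fun y => y + 3) (x + g))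
      exact (Measurable.indicator (by fun_prop) measurableSet_Iic).comp (by fun_prop)
    · refine Set.indicator_le_indicator' fun _ => ?_
      have := Real.add_one_le_exp (-(x + g))
      linarith
  · have hi3 : Integrable (fun g => x + g) (gaussianReal 0 v) :=
      (integrable_const x).add (integrable_id_gaussianReal v)
    rw [integral_add hi3 (integrable_const _),
      integral_add (integrable_const x) (integrable_id_gaussianReal v)]
    have : ∫ g, g ∂gaussianReal 0 v = 0 := integral_id_gaussianReal
    simp [this]

theorem kill_affine_shift_le {v : ℝ≥0} (hv : 0 < v) (hv1 : v ≤ 1) {x : ℝ} (hx : 0 ≤ x) (δ : ℝ) :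
    kill v (fun y => ENNReal.ofReal (y + 3)) (x + δ) ≤
      ENNReal.ofReal (1 + |δ|) * ENNReal.ofReal (x + 3) := by
  have hmono : ∀ x y : ℝ, x ≤ y → kill v (fun y => ENNReal.ofReal (y + 3)) x ≤
      kill v (fun y => ENNReal.ofReal (y + 3)) y := by
    intro x y hxy
    refine lintegral_mono fun g => ?_
    simp only [Set.indicator, Set.mem_Ioi]
    split_ifs with h1 h2
    · exact ENNReal.ofReal_le_ofReal (by linarith)
    · linarith
    · simp
    · simp
  rw [← ENNReal.ofReal_mul (by positivity)]
  have := le_abs_self δ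
  have := abs_nonneg δ
  refine (hmono _ _ (show x + δ ≤ x + |δ| by linarith)).trans
    ((kill_affine_le hv hv1 (by positivity)).trans (ENNReal.ofReal_le_ofReal ?_))
  nlinarith

/-- A free step multiplies the mean of `exp (-y)` by `exp (v / 2) ≥ 1 + v / 2`, so `4 - exp (-y)`
strictly loses `v / 2 * exp (-x)`. Summing these losses bounds the Green's function. -/
theorem kill_exp_le {v : ℝ≥0} (hv : 0 < v) (hv1 : v ≤ 1) {x : ℝ} (hx : 0 ≤ x) :
    kill v (fun y => ENNReal.ofReal (4 - Real.exp (-y))) x +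
      ENNReal.ofReal (v / 2 * Real.exp (-x)) ≤ ENNReal.ofReal (4 - Real.exp (-x)) := by
  have hi2 : Integrable (fun g => 4 - Real.exp (-(x + g))) (gaussianReal 0 v) :=
    (integrable_const _).sub (integrable_exp_neg_gaussianReal v x)
  have h := kill_ofReal_le (v := v) (f := fun y => 4 - Real.exp (-y)) (x := x)
    (b := 4 - Real.exp (v / 2) * Real.exp (-x)) (by fun_prop)
    (fun y hy => by
      have : Real.exp (-y) ≤ 1 := Real.exp_le_one_iff.2 (by linarith)
      linarith) hi2 (integral_overshoot_nonneg hv hv1 hx)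
    (by
      rw [integral_sub (integrable_const _) (integrable_exp_neg_gaussianReal v x),
        integral_exp_neg_gaussianReal]
      simp)
  refine (add_le_add h le_rfl).trans ?_
  have h1 : Real.exp (-x) ≤ 1 := Real.exp_le_one_iff.2 (by linarith)
  have h2 := Real.exp_pos (-x)
  have h3 : Real.exp (v / 2) ≤ 2 := (Real.exp_le_exp.2 (by
      have : (v : ℝ) ≤ 1 := by exact_mod_cast hv1
      linarith)).trans exp_half_le_two
  have h4 := Real.add_one_le_exp ((v : ℝ) / 2)
  rw [← ENNReal.ofReal_add (by nlinarith) (by positivity)]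
  refine ENNReal.ofReal_le_ofReal ?_
  nlinarith

/-! ### Reflection bounds for survival of the killed walk. -/

/-- The difference of the two reflected Gaussian probabilities. -/
noncomputable def reflectGap (y : ℝ) (s : ℝ≥0) (x : ℝ) : ℝ :=
  ∫ g, ((Set.Ici y).indicator 1 (x + g) - (Set.Ici y).indicator 1 (-x + g)) ∂gaussianReal 0 s

theorem integrable_indicator_Ici (y x : ℝ) (s : ℝ≥0) :
    Integrable (fun g => (Set.Ici y).indicator (1 : ℝ → ℝ) (x + g)) (gaussianReal 0 s) := by
  refine (integrable_const (1 : ℝ)).mono (Measurable.aestronglyMeasurable ?_)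
    (ae_of_all _ fun g => norm_indicator_le_norm_self (1 : ℝ → ℝ) (x + g))
  exact (Measurable.indicator measurable_one measurableSet_Ici).comp (by fun_prop)

theorem reflectGap_nonpos (y : ℝ) (s : ℝ≥0) {x : ℝ} (hx : x ≤ 0) : reflectGap y s x ≤ 0 := by
  refine integral_nonpos fun g => ?_
  simp only [Set.indicator, Set.mem_Ici, Pi.one_apply, Pi.zero_apply]
  split_ifs <;> linarith

theorem measurable_reflectGap (y : ℝ) (s : ℝ≥0) : Measurable (reflectGap y s) := by
  have hm : Measurable ((Set.Ici y).indicator (1 : ℝ → ℝ)) :=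
    Measurable.indicator measurable_one measurableSet_Ici
  unfold reflectGap
  have : Measurable fun p : ℝ × ℝ => (Set.Ici y).indicator (1 : ℝ → ℝ) (p.1 + p.2) -
      (Set.Ici y).indicator (1 : ℝ → ℝ) (-p.1 + p.2) := by fun_prop
  exact (this.stronglyMeasurable.integral_prod_right (ν := gaussianReal 0 s)).measurable

theorem abs_reflectGap_le (y : ℝ) (s : ℝ≥0) (x : ℝ) : |reflectGap y s x| ≤ 1 := by
  unfold reflectGap
  have := norm_integral_le_of_norm_le_const (μ := gaussianReal 0 s) (C := 1)
    (f := fun g => (Set.Ici y).indicator (1 : ℝ → ℝ) (x + g) -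
      (Set.Ici y).indicator (1 : ℝ → ℝ) (-x + g)) (ae_of_all _ fun g => by
        simp only [Set.indicator, Set.mem_Ici, Pi.one_apply]
        split_ifs <;> norm_num)
  simpa using this

/-- Gaussian laws form a convolution semigroup and are symmetric, so the odd function `reflectGap y
s` evolves under a free step by adding the variances. -/
theorem integral_reflectGap (y : ℝ) (s v : ℝ≥0) (x : ℝ) :
    ∫ g, reflectGap y s (x + g) ∂gaussianReal 0 v = reflectGap y (s + v) x := by
  have hm : Measurable ((Set.Ici y).indicator (1 : ℝ → ℝ)) :=
    Measurable.indicator measurable_one measurableSet_Ici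
  have hsemi : ∀ x, ∫ g, ∫ g', (Set.Ici y).indicator (1 : ℝ → ℝ) (x + g + g') ∂gaussianReal 0 s
      ∂gaussianReal 0 v = ∫ g, (Set.Ici y).indicator (1 : ℝ → ℝ) (x + g) ∂gaussianReal 0 (s + v) := by
    intro x
    have := gaussianReal_conv_gaussianReal (m₁ := 0) (m₂ := 0) (v₁ := v) (v₂ := s)
    rw [add_zero, add_comm v s] at this
    rw [← this, Measure.conv, integral_map (by fun_prop)
      (Measurable.aestronglyMeasurable (by fun_prop)), integral_prod]
    · simp only [add_assoc]
    · refine (integrable_const (1 : ℝ)).mono (Measurable.aestronglyMeasurable (by fun_prop))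
        (ae_of_all _ fun g => norm_indicator_le_norm_self (1 : ℝ → ℝ) _)
  have hi : ∀ x, Integrable (fun g => ∫ g', (Set.Ici y).indicator (1 : ℝ → ℝ) (x + g + g')
      ∂gaussianReal 0 s) (gaussianReal 0 v) := by
    intro x
    have hmm : Measurable fun p : ℝ × ℝ => (Set.Ici y).indicator (1 : ℝ → ℝ) (x + p.1 + p.2) := by
      fun_prop
    refine (integrable_const (1 : ℝ)).mono
      (hmm.stronglyMeasurable.integral_prod_right (ν := gaussianReal 0 s)).aestronglyMeasurable
      (ae_of_all _ fun g => ?_)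
    have := norm_integral_le_of_norm_le_const (μ := gaussianReal 0 s) (C := 1)
      (f := fun g' => (Set.Ici y).indicator (1 : ℝ → ℝ) (x + g + g')) (ae_of_all _ fun g' => by
        simpa using norm_indicator_le_norm_self (1 : ℝ → ℝ) (x + g + g'))
    simpa using this
  have hexp : ∀ s x, reflectGap y s x =
      ∫ g, (Set.Ici y).indicator (1 : ℝ → ℝ) (x + g) ∂gaussianReal 0 s -
      ∫ g, (Set.Ici y).indicator (1 : ℝ → ℝ) (-x + g) ∂gaussianReal 0 s := fun s x =>
    integral_sub (integrable_indicator_Ici y x s) (integrable_indicator_Ici y (-x) s)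
  have hneg := integral_gaussianReal_neg v (fun g =>
    ∫ g', (Set.Ici y).indicator (1 : ℝ → ℝ) (-x + g + g') ∂gaussianReal 0 s)
  have hineg : Integrable (fun g => ∫ g', (Set.Ici y).indicator (1 : ℝ → ℝ) (-x + -g + g')
      ∂gaussianReal 0 s) (gaussianReal 0 v) := by
    have h := gaussianReal_map_neg (μ := 0) (v := v)
    rw [neg_zero] at h
    have i1 := hi (-x)
    rw [← h] at i1
    exact i1.comp_measurable (by fun_prop)
  simp_rw [hexp, neg_add]
  rw [integral_sub (hi x) hineg, hneg, hsemi, hsemi]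

/-- The gap is nonpositive below the barrier, so killing there can only raise its mean. This
subharmonicity takes the place of the exact reflection principle, which a discrete walk does not
satisfy. -/
theorem reflectGap_le_kill (y : ℝ) (s v : ℝ≥0) (x : ℝ) :
    ENNReal.ofReal (reflectGap y (s + v) x) ≤
      kill v (fun z => ENNReal.ofReal (reflectGap y s z)) x := by
  have hm := measurable_reflectGap y s
  have hi : Integrable (fun g => reflectGap y s (x + g)) (gaussianReal 0 v) :=
    (integrable_const (1 : ℝ)).mono (Measurable.aestronglyMeasurable (by fun_prop))
      (ae_of_all _ fun g => by simpa using abs_reflectGap_le y s (x + g))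
  have e : kill v (fun z => ENNReal.ofReal (reflectGap y s z)) x =
      ∫⁻ g, ENNReal.ofReal (reflectGap y s (x + g)) ∂gaussianReal 0 v := by
    refine lintegral_congr fun g => ?_
    simp only [Set.indicator, Set.mem_Ioi]
    split_ifs with h
    · rfl
    · rw [ENNReal.ofReal_of_nonpos (reflectGap_nonpos y s (not_lt.1 h))]
  have hp : Integrable (fun g => max (reflectGap y s (x + g)) 0) (gaussianReal 0 v) :=
    hi.sup (integrable_zero _ _ _)
  have e2 : ∫⁻ g, ENNReal.ofReal (reflectGap y s (x + g)) ∂gaussianReal 0 v =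
      ENNReal.ofReal (∫ g, max (reflectGap y s (x + g)) 0 ∂gaussianReal 0 v) := by
    rw [ofReal_integral_eq_lintegral_ofReal hp (ae_of_all _ fun g => le_max_right _ _)]
    refine lintegral_congr fun g => ?_
    rcases le_total 0 (reflectGap y s (x + g)) with h | h
    · rw [max_eq_left h]
    · rw [max_eq_right h, ENNReal.ofReal_of_nonpos h, ENNReal.ofReal_zero]
  rw [e, e2, ← integral_reflectGap]
  exact ENNReal.ofReal_le_ofReal (integral_mono hi hp fun g => le_max_left _ _)

theorem ofReal_reflectGap_zero_le {y : ℝ} (x : ℝ) :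
    ENNReal.ofReal (reflectGap y 0 x) ≤ (Set.Ici y).indicator 1 x := by
  have : reflectGap y 0 x ≤ (Set.Ici y).indicator 1 x := by
    simp only [reflectGap, gaussianReal_zero_var, integral_dirac, add_zero]
    have : 0 ≤ (Set.Ici y).indicator (1 : ℝ → ℝ) (-x) := Set.indicator_nonneg (by simp) _
    linarith
  refine (ENNReal.ofReal_le_ofReal this).trans ?_
  simp only [Set.indicator]
  split_ifs <;> simp

/-- The gap is the Gaussian mass of an interval of length `2a` inside `[-2√N, 2√N]`. There the
exponent is at least `-4N / (N / 4) = -16`, and the normalizing factor is at least `1 / (2√N)`. -/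
theorem le_reflectGap {N : ℝ} {s : ℝ≥0} {a : ℝ} (hN : 1 ≤ N) (ha : 0 < a)
    (haN : a ≤ Real.sqrt N) (hs1 : N / 8 ≤ s) (hs2 : s ≤ N / 2) :
    Real.exp (-16) * (a / Real.sqrt N) ≤ reflectGap (Real.sqrt N) s a := by
  set y := Real.sqrt N
  have hy : 1 ≤ y := Real.one_le_sqrt.2 hN
  have hyN : y ^ 2 = N := Real.sq_sqrt (by linarith)
  have hs : (0 : ℝ) < s := by linarith
  have hs0 : s ≠ 0 := by rintro rfl; simp at hs
  have e : reflectGap y s a = ∫ g, (Set.Ico (y - a) (y + a)).indicator 1 g ∂gaussianReal 0 s := by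
    unfold reflectGap
    congr 1 with g
    simp only [Set.indicator, Set.mem_Ici, Set.mem_Ico, Pi.one_apply]
    by_cases h1 : y ≤ a + g <;> by_cases h2 : y ≤ -a + g
    · rw [if_pos h1, if_pos h2, if_neg (by intro h; linarith [h.2])]; norm_num
    · rw [if_pos h1, if_neg h2, if_pos (by constructor <;> linarith)]; norm_num
    · linarith
    · rw [if_neg h1, if_neg h2, if_neg (by intro h; linarith [h.1])]; norm_num
  have hlow : ∀ g ∈ Set.Ico (y - a) (y + a), Real.exp (-16) / (2 * y) ≤ gaussianPDFReal 0 s g := by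
    intro g hg
    unfold gaussianPDFReal
    have h1 : Real.sqrt (2 * Real.pi * s) ≤ 2 * y := by
      rw [Real.sqrt_le_left (by positivity)]
      nlinarith [Real.pi_lt_four, Real.pi_pos]
    have h2 : -16 ≤ -(g - 0) ^ 2 / (2 * s) := by
      rw [le_div_iff₀ (by positivity)]
      have := hg.1
      have := hg.2
      nlinarith
    rw [div_eq_inv_mul]
    gcongr
  rw [e, integral_gaussianReal_eq_integral_smul hs0]
  have e3 : ∫ x, gaussianPDFReal 0 s x • (Set.Ico (y - a) (y + a)).indicator (1 : ℝ → ℝ) x =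
      ∫ x in Set.Ico (y - a) (y + a), gaussianPDFReal 0 s x := by
    rw [← integral_indicator measurableSet_Ico]
    congr 1 with x
    simp [Set.indicator]
  rw [e3]
  have e4 : ∫ x in Set.Ico (y - a) (y + a), Real.exp (-16) / (2 * y) =
      Real.exp (-16) * (a / y) := by
    rw [setIntegral_const, measureReal_def, Real.volume_Ico, ENNReal.toReal_ofReal (by linarith),
      smul_eq_mul]
    field_simp
    ring
  rw [← e4]
  exact setIntegral_mono_on (integrable_const _) (integrable_gaussianPDFReal 0 s).integrableOn
    measurableSet_Ico hlow

/-! ### The canonical Gaussian sequence -/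

/-- The law of a sequence of independent standard complex Gaussians. -/
noncomputable def gaussSeq : Measure (ℕ → ℂ) :=
  Measure.infinitePi fun _ => stdComplexGaussian

instance : IsProbabilityMeasure gaussSeq := by
  unfold gaussSeq; infer_instance

/-- The real linear form `x ↦ ∑ k ∈ s, Re (x k * b k)`. -/
def linForm (s : Finset ℕ) (b x : ℕ → ℂ) : ℝ := ∑ k ∈ s, (x k * b k).re

@[fun_prop]
theorem measurable_linForm (s : Finset ℕ) (b : ℕ → ℂ) : Measurable (linForm s b) := by
  unfold linForm
  fun_prop

theorem map_re_mul_stdComplexGaussian (b : ℂ) :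
    stdComplexGaussian.map (fun x => (x * b).re) = gaussianReal 0 (‖b‖₊ ^ 2 / 2) := by
  have hind : IndepFun (fun p : ℝ × ℝ => p.1 * b.re) (fun p : ℝ × ℝ => p.2 * (-b.im))
      ((gaussianReal 0 (1 / 2)).prod (gaussianReal 0 (1 / 2))) :=
    indepFun_prod (X := fun x : ℝ => x * b.re) (Y := fun x : ℝ => x * (-b.im))
      (by fun_prop) (by fun_prop)
  have h1 : ((gaussianReal 0 (1 / 2)).prod (gaussianReal 0 (1 / 2))).map
      (fun p : ℝ × ℝ => p.1 * b.re) = gaussianReal 0 (NNReal.mk (b.re ^ 2) (sq_nonneg _) * (1 / 2)) := by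
    have : (fun p : ℝ × ℝ => p.1 * b.re) = (fun x => x * b.re) ∘ Prod.fst := rfl
    rw [this, ← Measure.map_map (by fun_prop) (by fun_prop), Measure.map_fst_prod]
    simp [gaussianReal_map_mul_const]
  have h2 : ((gaussianReal 0 (1 / 2)).prod (gaussianReal 0 (1 / 2))).map
      (fun p : ℝ × ℝ => p.2 * (-b.im)) =
        gaussianReal 0 (NNReal.mk ((-b.im) ^ 2) (sq_nonneg _) * (1 / 2)) := by
    have : (fun p : ℝ × ℝ => p.2 * (-b.im)) = (fun x => x * (-b.im)) ∘ Prod.snd := rfl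
    rw [this, ← Measure.map_map (by fun_prop) (by fun_prop), Measure.map_snd_prod]
    rw [measure_univ, one_smul, gaussianReal_map_mul_const, mul_zero]
  have h := gaussianReal_add_gaussianReal_of_indepFun hind h1 h2
  unfold stdComplexGaussian
  rw [Measure.map_map (by fun_prop) (Complex.measurableEquivRealProd.symm.measurable)]
  have e : (fun x : ℂ => (x * b).re) ∘ Complex.measurableEquivRealProd.symm =
      (fun p : ℝ × ℝ => p.1 * b.re) + fun p : ℝ × ℝ => p.2 * (-b.im) := by
    ext p
    simp [Complex.mul_re, Complex.measurableEquivRealProd_symm_apply, sub_eq_add_neg]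
  rw [e, h]
  congr 1
  · simp
  · ext
    have := Complex.sq_norm b
    rw [Complex.normSq_apply] at this
    simp only [NNReal.coe_add, NNReal.coe_mul, NNReal.coe_mk, NNReal.coe_div, NNReal.coe_pow,
      coe_nnnorm, NNReal.coe_one, NNReal.coe_ofNat]
    rw [this]
    ring

/-- Restriction of a sequence to a set of indices, extended by zero. -/
def trunc (s : Finset ℕ) (x : ℕ → ℂ) (k : ℕ) : ℂ := if k ∈ s then x k else 0

theorem linForm_trunc {s t : Finset ℕ} (h : s ⊆ t) (b x : ℕ → ℂ) :
    linForm s b (trunc t x) = linForm s b x := by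
  unfold linForm
  refine Finset.sum_congr rfl fun k hk => ?_
  rw [trunc, if_pos (h hk)]

/-- Invariance under `trunc` says that a function depends only on finitely many coordinates. It then
factors through them, with zero extension as the section, and disjoint sets of coordinates are
independent. -/
theorem indepFun_of_trunc {A B : Type*} [MeasurableSpace A] [MeasurableSpace B]
    {f : (ℕ → ℂ) → A} {g : (ℕ → ℂ) → B} {s t : Finset ℕ} (hst : Disjoint s t)
    (hf : Measurable f) (hg : Measurable g)
    (hfs : ∀ x, f (trunc s x) = f x) (hgt : ∀ x, g (trunc t x) = g x) :
    IndepFun f g gaussSeq := by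
  have hI : iIndepFun (fun (k : ℕ) (x : ℕ → ℂ) => x k) gaussSeq :=
    iIndepFun_infinitePi (P := fun _ : ℕ => stdComplexGaussian) (X := fun _ => id)
      (fun _ => measurable_id)
  have h := hI.indepFun_finset s t hst (fun k => measurable_pi_apply k)
  let ext (s : Finset ℕ) (u : s → ℂ) (k : ℕ) : ℂ := if h : k ∈ s then u ⟨k, h⟩ else 0
  have hext : ∀ s, Measurable (ext s) := by
    intro s
    refine measurable_pi_lambda _ fun k => ?_
    by_cases hk : k ∈ s
    · simp only [ext, hk, dite_true]; fun_prop
    · simp only [ext, hk, dite_false]; fun_prop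
  have he : ∀ s x, ext s (fun i : s => x i) = trunc s x := by
    intro s x
    ext k
    simp only [ext, trunc]
    split_ifs <;> rfl
  have h2 := h.comp (φ := fun u => f (ext s u)) (ψ := fun u => g (ext t u))
    (hf.comp (hext s)) (hg.comp (hext t))
  convert h2 using 1
  · ext x
    simp only [Function.comp, he, hfs]
  · ext x
    simp only [Function.comp, he, hgt]

theorem lintegral_of_indepFun {Ω A B : Type*} [MeasurableSpace Ω] [MeasurableSpace A]
    [MeasurableSpace B] {μ : Measure Ω} [IsProbabilityMeasure μ] {f : Ω → A} {g : Ω → B}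
    (hf : Measurable f) (hg : Measurable g) (h : IndepFun f g μ) {Φ : A × B → ℝ≥0∞}
    (hΦ : Measurable Φ) :
    ∫⁻ x, Φ (f x, g x) ∂μ = ∫⁻ x, ∫⁻ b, Φ (f x, b) ∂μ.map g ∂μ := by
  have := Measure.isProbabilityMeasure_map (μ := μ) hg.aemeasurable
  have := Measure.isProbabilityMeasure_map (μ := μ) hf.aemeasurable
  have h1 := (indepFun_iff_map_prod_eq_prod_map_map hf.aemeasurable hg.aemeasurable).1 h
  calc ∫⁻ x, Φ (f x, g x) ∂μ = ∫⁻ p, Φ p ∂μ.map (fun x => (f x, g x)) :=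
        (lintegral_map hΦ (hf.prodMk hg)).symm
    _ = ∫⁻ a, ∫⁻ b, Φ (a, b) ∂μ.map g ∂μ.map f := by
        rw [h1, lintegral_prod _ hΦ.aemeasurable]
    _ = _ := lintegral_map hΦ.lintegral_prod_right' hf

/-- The variance of a linear form. -/
noncomputable def varForm (s : Finset ℕ) (b : ℕ → ℂ) : ℝ≥0 := ∑ k ∈ s, ‖b k‖₊ ^ 2 / 2

theorem map_linForm (s : Finset ℕ) (b : ℕ → ℂ) :
    gaussSeq.map (linForm s b) = gaussianReal 0 (varForm s b) := by
  induction s using Finset.induction_on with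
  | empty =>
    have : linForm ∅ b = fun _ => 0 := by ext; simp [linForm]
    rw [this, Measure.map_const]
    simp [varForm]
  | insert k s hk ih =>
    have e : linForm (insert k s) b = linForm {k} b + linForm s b := by
      ext x
      simp [linForm, Finset.sum_insert hk]
    have hind : IndepFun (linForm {k} b) (linForm s b) gaussSeq :=
      indepFun_of_trunc (s := {k}) (t := s) (by simpa using hk) (measurable_linForm _ _)
        (measurable_linForm _ _) (linForm_trunc le_rfl b) (linForm_trunc le_rfl b)
    have h1 : gaussSeq.map (linForm {k} b) = gaussianReal 0 (‖b k‖₊ ^ 2 / 2) := by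
      have : linForm {k} b = (fun x => (x * b k).re) ∘ fun x : ℕ → ℂ => x k := by
        ext x; simp [linForm]
      rw [this, ← Measure.map_map (by fun_prop) (by fun_prop), gaussSeq,
        Measure.infinitePi_map_eval, map_re_mul_stdComplexGaussian]
    rw [e, gaussianReal_add_gaussianReal_of_indepFun hind h1 ih, add_zero]
    simp [varForm, Finset.sum_insert hk]

theorem charFun_map_linForm (s : Finset ℕ) (b : ℕ → ℂ) :
    ∫ x, Complex.exp (linForm s b x * Complex.I) ∂gaussSeq =
      Complex.exp (-(varForm s b / 2 : ℝ)) := by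
  have h := charFun_gaussianReal (μ := 0) (v := varForm s b) 1
  rw [← map_linForm, charFun_apply_real, integral_map (by fun_prop) (by fun_prop)] at h
  simpa [neg_div] using h

/-- Uncorrelated linear forms are independent Gaussians. -/
theorem map_linForm_prod (s : Finset ℕ) (b d : ℕ → ℂ)
    (h : ∑ k ∈ s, ((b k).re * (d k).re + (b k).im * (d k).im) = 0) :
    gaussSeq.map (fun x => (linForm s b x, linForm s d x)) =
      (gaussianReal 0 (varForm s b)).prod (gaussianReal 0 (varForm s d)) := by
  have hm : Measurable fun x => (linForm s b x, linForm s d x) := by fun_prop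
  have := Measure.isProbabilityMeasure_map (μ := gaussSeq) hm.aemeasurable
  refine Measure.ext_of_charFunDual ?_
  ext L
  rw [charFunDual_prod, charFunDual_apply, integral_map hm.aemeasurable (by fun_prop)]
  set p : ℝ := L (1, 0) with hp
  set q : ℝ := L (0, 1) with hq
  have hL : ∀ u w : ℝ, L (u, w) = p * u + q * w := by
    intro u w
    have : ((u, w) : ℝ × ℝ) = u • (1, 0) + w • (0, 1) := by simp
    rw [this, map_add, map_smul, map_smul, smul_eq_mul, smul_eq_mul]
    ring
  have e1 : ∀ x, L (linForm s b x, linForm s d x) =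
      linForm s (fun k => (p : ℂ) * b k + (q : ℂ) * d k) x := by
    intro x
    rw [hL]
    simp only [linForm, Finset.mul_sum, ← Finset.sum_add_distrib]
    refine Finset.sum_congr rfl fun k _ => ?_
    simp only [Complex.mul_re, Complex.add_re, Complex.add_im, Complex.mul_im, Complex.ofReal_re,
      Complex.ofReal_im]
    ring
  simp_rw [e1]
  rw [charFun_map_linForm, charFunDual_apply, charFunDual_apply]
  have e2 : ∀ (v : ℝ≥0) (p : ℝ), ∫ x, Complex.exp ((p * x : ℝ) * Complex.I) ∂gaussianReal 0 v =
      Complex.exp (-(p ^ 2 * v / 2 : ℝ)) := by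
    intro v p
    have h := charFun_gaussianReal (μ := 0) (v := v) p
    rw [charFun_apply_real] at h
    simp only [Complex.ofReal_mul]
    rw [h]
    congr 1
    push_cast
    ring
  have e3 : ∀ u : ℝ, (L.comp (ContinuousLinearMap.inl ℝ ℝ ℝ)) u = p * u := by
    intro u; simp [hL]
  have e4 : ∀ u : ℝ, (L.comp (ContinuousLinearMap.inr ℝ ℝ ℝ)) u = q * u := by
    intro u; simp [hL]
  simp_rw [e3, e4, e2, ← Complex.exp_add]
  congr 1
  norm_cast
  -- The cross term of the variance of `p b + q d` is the covariance that `h` annihilates, so the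
  -- characteristic function factors.
  have e5 : ((varForm s fun k => (p : ℂ) * b k + (q : ℂ) * d k : ℝ≥0) : ℝ) =
      p ^ 2 * varForm s b + q ^ 2 * varForm s d +
        p * q * ∑ k ∈ s, ((b k).re * (d k).re + (b k).im * (d k).im) := by
    simp only [varForm, NNReal.coe_sum, NNReal.coe_div, NNReal.coe_pow, coe_nnnorm,
      Finset.mul_sum, ← Finset.sum_add_distrib, Complex.sq_norm, Complex.normSq_apply]
    refine Finset.sum_congr rfl fun k _ => ?_
    simp only [Complex.mul_re, Complex.add_re, Complex.add_im, Complex.mul_im, Complex.ofReal_re,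
      Complex.ofReal_im, NNReal.coe_ofNat]
    ring
  rw [NNReal.coe_div, e5, h, NNReal.coe_ofNat]
  ring

/-! ### Variances and covariances of dyadic blocks -/

/-- The coefficient of `X k` in the exponent of `F` at the point `r * exp (i θ)`. -/
noncomputable def coef (r θ : ℝ) (k : ℕ) : ℂ :=
  ((r : ℂ) * Complex.exp ((θ : ℂ) * Complex.I)) ^ k / (Real.sqrt (k : ℝ) : ℂ)

/-- The dyadic block `[2 ^ j, 2 ^ (j + 1))`. -/
def block (j : ℕ) : Finset ℕ := Finset.Ico (2 ^ j) (2 ^ (j + 1))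

/-- The variance of a dyadic block. -/
noncomputable def blockVar (r : ℝ) (j : ℕ) : ℝ≥0 := varForm (block j) (coef r 0)

/-- The covariance of a dyadic block at two points. -/
noncomputable def blockCov (r θ θ' : ℝ) (j : ℕ) : ℝ :=
  ∑ k ∈ block j, ((coef r θ k).re * (coef r θ' k).re + (coef r θ k).im * (coef r θ' k).im) / 2

/-- The logarithm of the second moment of the product of the first `m` blocks. -/
noncomputable def logSecond (r : ℝ) (m : ℕ) : ℝ := ∑ j ∈ Finset.range m, 2 * (blockVar r j : ℝ)

theorem norm_sq_coef {r : ℝ} (hr : 0 ≤ r) (θ : ℝ) (k : ℕ) :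
    ‖coef r θ k‖ ^ 2 = r ^ (2 * k) / k := by
  unfold coef
  rw [norm_div, norm_pow, norm_mul, Complex.norm_exp_ofReal_mul_I, mul_one, Complex.norm_real,
    Complex.norm_real, Real.norm_of_nonneg hr, Real.norm_of_nonneg (Real.sqrt_nonneg _), div_pow,
    Real.sq_sqrt (by positivity), ← pow_mul, mul_comm k 2]

theorem coe_varForm_coef {r : ℝ} (hr : 0 ≤ r) (θ : ℝ) (s : Finset ℕ) :
    (varForm s (coef r θ) : ℝ) = ∑ k ∈ s, r ^ (2 * k) / k / 2 := by
  simp only [varForm, NNReal.coe_sum, NNReal.coe_div, NNReal.coe_pow, coe_nnnorm,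
    norm_sq_coef hr, NNReal.coe_ofNat]

theorem varForm_coef {r : ℝ} (hr : 0 ≤ r) (θ : ℝ) (j : ℕ) :
    varForm (block j) (coef r θ) = blockVar r j := by
  ext
  rw [blockVar, coe_varForm_coef hr, coe_varForm_coef hr]

theorem coe_blockVar {r : ℝ} (hr : 0 ≤ r) (j : ℕ) :
    (blockVar r j : ℝ) = ∑ k ∈ block j, r ^ (2 * k) / k / 2 :=
  coe_varForm_coef hr 0 _

theorem logSecond_eq {r : ℝ} (hr : 0 ≤ r) (m : ℕ) :
    logSecond r m = ∑ k ∈ Finset.Ico (1 : ℕ) (2 ^ m), r ^ (2 * k) / k := by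
  unfold logSecond
  induction m with
  | zero => simp
  | succ m ih =>
    rw [Finset.sum_range_succ, ih, coe_blockVar hr, block, Finset.mul_sum,
      ← Finset.sum_Ico_consecutive _ (Nat.one_le_two_pow (n := m))
        (Nat.pow_le_pow_right (by norm_num) (Nat.le_add_right m 1))]
    congr 1
    refine Finset.sum_congr rfl fun k _ => ?_
    ring

theorem blockVar_le {r : ℝ} (hr : 0 ≤ r) (hr1 : r ≤ 1) (j : ℕ) : (blockVar r j : ℝ) ≤ 1 / 2 := by
  rw [coe_blockVar hr]
  have h : ∀ k ∈ block j, r ^ (2 * k) / k / 2 ≤ 1 / 2 ^ j / 2 := by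
    intro k hk
    have hk1 : (2 : ℝ) ^ j ≤ k := by exact_mod_cast (Finset.mem_Ico.1 hk).1
    have : r ^ (2 * k) ≤ 1 := pow_le_one₀ hr hr1
    gcongr
  refine (Finset.sum_le_card_nsmul _ _ _ h).trans (le_of_eq ?_)
  rw [block, Nat.card_Ico, pow_succ, nsmul_eq_mul]
  have : 2 ^ j * 2 - 2 ^ j = 2 ^ j := by omega
  rw [this]
  push_cast
  field_simp

/-- `r ^ (2k) = exp (2k log r) ≥ exp (-1/2)`: below the index `2 ^ N` the damping costs a constant
only. -/
theorem pow_ge_of_log {r : ℝ} (hr : 0 < r) {N : ℕ} (hN : -Real.log r * 2 ^ N ≤ 1 / 4) {k : ℕ}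
    (hk : k ≤ 2 ^ N) : 1 / 2 ≤ r ^ (2 * k) := by
  rcases le_total 0 (Real.log r) with h0 | h0
  · have h1 : 1 ≤ r := by
      by_contra hlt
      exact absurd (Real.log_neg hr (not_le.1 hlt)) (not_lt.2 h0)
    have := one_le_pow₀ h1 (n := 2 * k)
    linarith
  have hk1 : (k : ℝ) ≤ 2 ^ N := by exact_mod_cast hk
  have e : r ^ (2 * k) = Real.exp (2 * k * Real.log r) := by
    rw [show (2 * k * Real.log r : ℝ) = ((2 * k : ℕ) : ℝ) * Real.log r by push_cast; ring,
      Real.exp_nat_mul, Real.exp_log hr]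
  rw [e]
  have h1 : -(1 / 2) ≤ 2 * k * Real.log r := by nlinarith
  refine le_trans ?_ (Real.exp_le_exp.2 h1)
  rw [Real.exp_neg, one_div (2 : ℝ)]
  exact inv_anti₀ (Real.exp_pos _) (by simpa using exp_half_le_two)

theorem le_blockVar {r : ℝ} (hr : 0 < r) {N : ℕ} (hN : -Real.log r * 2 ^ N ≤ 1 / 4) {j : ℕ}
    (hj : j < N) : 1 / 8 ≤ (blockVar r j : ℝ) := by
  rw [coe_blockVar hr.le]
  have h : ∀ k ∈ block j, (1 / 2) / 2 ^ (j + 1) / 2 ≤ r ^ (2 * k) / k / 2 := by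
    intro k hk
    have hk0 := (Finset.mem_Ico.1 hk).1
    have hk2 := (Finset.mem_Ico.1 hk).2
    have hkp : (0 : ℝ) < k := by
      exact_mod_cast lt_of_lt_of_le (by positivity) hk0
    have hk1 : (k : ℝ) ≤ 2 ^ (j + 1) := by exact_mod_cast hk2.le
    have : 1 / 2 ≤ r ^ (2 * k) := pow_ge_of_log hr hN
      (hk2.le.trans (Nat.pow_le_pow_right (by norm_num) hj))
    gcongr
  refine le_trans (le_of_eq ?_) (Finset.card_nsmul_le_sum _ _ _ h)
  rw [block, Nat.card_Ico, pow_succ, nsmul_eq_mul]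
  have : 2 ^ j * 2 - 2 ^ j = 2 ^ j := by omega
  rw [this]
  push_cast
  rw [pow_succ]
  field_simp
  norm_num

theorem exp_logSecond_le {r : ℝ} (hr : 0 ≤ r) (hr1 : r ≤ 1) (m : ℕ) :
    Real.exp (logSecond r m) ≤ 3 * 2 ^ m := by
  have h1 : logSecond r m ≤ 1 + Real.log (2 ^ m) := by
    have h2 := harmonic_le_one_add_log (2 ^ m)
    rw [harmonic_eq_sum_Icc] at h2
    push_cast at h2
    refine le_trans ?_ h2
    rw [logSecond_eq hr]
    refine (Finset.sum_le_sum (g := fun k : ℕ => (k : ℝ)⁻¹) fun k _ => ?_).trans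
      (Finset.sum_le_sum_of_subset_of_nonneg ?_ fun k _ _ => by positivity)
    · rw [div_eq_mul_inv]
      exact mul_le_of_le_one_left (by positivity) (pow_le_one₀ hr hr1)
    · intro k hk
      rw [Finset.mem_Ico] at hk
      exact Finset.mem_Icc.2 ⟨hk.1, hk.2.le⟩
  refine (Real.exp_le_exp.2 h1).trans ?_
  rw [Real.exp_add, Real.exp_log (by positivity)]
  have := Real.exp_one_lt_d9
  gcongr
  linarith

/-- By `exp u ≥ 1 + u`, each term loses at most `-2 log r` compared with `1 / k`. The total loss
over fewer than `2 ^ N` terms is at most `1/2`. -/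
theorem le_exp_logSecond {r : ℝ} (hr : 0 < r) {N : ℕ} (hN : -Real.log r * 2 ^ N ≤ 1 / 4)
    (hr1 : r ≤ 1) : 2 ^ N / 2 ≤ Real.exp (logSecond r N) := by
  have hlog : Real.log r ≤ 0 := Real.log_nonpos hr.le hr1
  have h1 : Real.log (2 ^ N) - 1 / 2 ≤ logSecond r N := by
    have h2 := log_add_one_le_harmonic (2 ^ N - 1)
    rw [harmonic_eq_sum_Icc] at h2
    have e1 : ((2 ^ N - 1 : ℕ) : ℝ) + 1 = 2 ^ N := by
      rw [Nat.cast_sub Nat.one_le_two_pow]; push_cast; ring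
    have e2 : Finset.Icc 1 (2 ^ N - 1) = Finset.Ico 1 (2 ^ N) := by
      ext k
      have := Nat.one_le_two_pow (n := N)
      simp only [Finset.mem_Icc, Finset.mem_Ico]
      omega
    have e3 : (((2 ^ N - 1 : ℕ) + 1 : ℕ) : ℝ) = 2 ^ N := by
      rw [Nat.sub_add_cancel Nat.one_le_two_pow]; push_cast; ring
    rw [e3, e2] at h2
    push_cast at h2
    have h3 : ∑ k ∈ Finset.Ico (1 : ℕ) (2 ^ N), ((k : ℝ)⁻¹ + 2 * Real.log r) ≤ logSecond r N := by
      rw [logSecond_eq hr.le]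
      refine Finset.sum_le_sum fun k hk => ?_
      have hk1 : (0 : ℝ) < k := by exact_mod_cast (Finset.mem_Ico.1 hk).1
      have e : r ^ (2 * k) = Real.exp (2 * k * Real.log r) := by
        rw [show (2 * k * Real.log r : ℝ) = ((2 * k : ℕ) : ℝ) * Real.log r by push_cast; ring,
          Real.exp_nat_mul, Real.exp_log hr]
      rw [le_div_iff₀ hk1, e]
      have := Real.add_one_le_exp (2 * k * Real.log r)
      have e5 : ((k : ℝ)⁻¹ + 2 * Real.log r) * k = 2 * k * Real.log r + 1 := by
        field_simp
        ring
      linarith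
    rw [Finset.sum_add_distrib, Finset.sum_const, Nat.card_Ico, nsmul_eq_mul] at h3
    have e4 : ((2 ^ N - 1 : ℕ) : ℝ) = 2 ^ N - 1 := by linarith
    rw [e4] at h3
    nlinarith
  refine le_trans ?_ (Real.exp_le_exp.2 h1)
  rw [Real.exp_sub, Real.exp_log (by positivity)]
  exact div_le_div_of_nonneg_left (by positivity) (Real.exp_pos _) exp_half_le_two

/-- Summation by parts for a power sum with decreasing weights. -/
theorem norm_one_sub_mul_sum_le {w : ℕ → ℝ} {ζ : ℂ} (hζ : ‖ζ‖ = 1) {A B : ℕ} (hAB : A ≤ B)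
    (hw0 : ∀ k, A ≤ k → 0 ≤ w k) (hw : ∀ k, A ≤ k → w (k + 1) ≤ w k) :
    ‖(1 - ζ) * ∑ k ∈ Finset.Ico A B, (w k : ℂ) * ζ ^ k‖ ≤ 2 * w A := by
  -- Keeping the boundary term on the left makes the induction telescope: raising `B` changes the
  -- expression only by `(w (B + 1) - w B) ζ ^ (B + 1)`.
  have key : ‖(1 - ζ) * ∑ k ∈ Finset.Ico A B, (w k : ℂ) * ζ ^ k + w B * ζ ^ B‖ ≤
      2 * w A - w B := by
    induction B, hAB using Nat.le_induction with
    | base =>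
      simp only [Finset.Ico_self, Finset.sum_empty, mul_zero, zero_add, norm_mul, norm_pow, hζ,
        one_pow, mul_one, Complex.norm_real, Real.norm_of_nonneg (hw0 A le_rfl)]
      linarith
    | succ B hB ih =>
      rw [Finset.sum_Ico_succ_top hB]
      have e : (1 - ζ) * (∑ k ∈ Finset.Ico A B, (w k : ℂ) * ζ ^ k + w B * ζ ^ B) +
          w (B + 1) * ζ ^ (B + 1) =
          ((1 - ζ) * ∑ k ∈ Finset.Ico A B, (w k : ℂ) * ζ ^ k + w B * ζ ^ B) +
          ((w (B + 1) - w B : ℝ) : ℂ) * ζ ^ (B + 1) := by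
        push_cast; ring
      rw [e]
      refine (norm_add_le _ _).trans ?_
      rw [norm_mul, norm_pow, hζ, one_pow, mul_one, Complex.norm_real, Real.norm_eq_abs,
        abs_of_nonpos (by linarith [hw B hB])]
      linarith
  have h2 : ‖(w B : ℂ) * ζ ^ B‖ = w B := by
    rw [norm_mul, norm_pow, hζ, one_pow, mul_one, Complex.norm_real,
      Real.norm_of_nonneg (hw0 B hAB)]
  have h3 := norm_sub_le ((1 - ζ) * ∑ k ∈ Finset.Ico A B, (w k : ℂ) * ζ ^ k + w B * ζ ^ B)
    (w B * ζ ^ B)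
  rw [add_sub_cancel_right, h2] at h3
  linarith

theorem half_abs_le_norm_one_sub_exp {φ : ℝ} (hφ : |φ| ≤ 1) :
    |φ| / 2 ≤ ‖1 - Complex.exp ((φ : ℂ) * Complex.I)‖ := by
  rw [norm_sub_rev, mul_comm, Complex.norm_exp_I_mul_ofReal_sub_one, norm_mul, Real.norm_eq_abs,
    Real.norm_eq_abs]
  have h1 : |φ| / 4 ≤ |Real.sin (φ / 2)| := by
    rw [Real.abs_sin_eq_sin_abs_of_abs_le_pi (by
      rw [abs_div, abs_two]; linarith [Real.pi_gt_three])]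
    rw [abs_div, abs_two]
    have h0 := abs_nonneg φ
    have h2 := Real.mul_le_sin (x := |φ| / 2) (by linarith) (by linarith [Real.pi_gt_three])
    have h3 : 1 / 2 ≤ 2 / Real.pi := by
      rw [div_le_div_iff₀ (by norm_num) Real.pi_pos]; linarith [Real.pi_lt_four]
    nlinarith
  rw [abs_two]
  linarith

theorem blockCov_eq {r : ℝ} (θ θ' : ℝ) (j : ℕ) :
    blockCov r θ θ' j = (∑ k ∈ Finset.Ico ((2 : ℕ) ^ j) (2 ^ (j + 1)), ((r ^ (2 * k) / k : ℝ) : ℂ) *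
      Complex.exp (((θ - θ' : ℝ) : ℂ) * Complex.I) ^ k).re / 2 := by
  rw [blockCov, ← Finset.sum_div, block, Complex.re_sum]
  congr 1
  refine Finset.sum_congr rfl fun k _ => ?_
  have e : ((r ^ (2 * k) / k : ℝ) : ℂ) * Complex.exp (((θ - θ' : ℝ) : ℂ) * Complex.I) ^ k =
      coef r θ k * (starRingEnd ℂ) (coef r θ' k) := by
    unfold coef
    simp only [map_div₀, map_pow, map_mul, Complex.conj_ofReal, ← Complex.exp_conj, Complex.conj_I]
    rw [div_mul_div_comm, ← Complex.ofReal_mul, Real.mul_self_sqrt (by positivity), ← mul_pow,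
      show (r : ℂ) * Complex.exp (θ * Complex.I) * (r * Complex.exp (θ' * -Complex.I)) =
        r ^ 2 * (Complex.exp (θ * Complex.I) * Complex.exp (θ' * -Complex.I)) by ring,
      ← Complex.exp_add]
    push_cast
    rw [mul_pow, ← pow_mul, div_mul_eq_mul_div]
    congr 4
    ring
  rw [e, Complex.mul_re, Complex.conj_re, Complex.conj_im]
  ring

/-- Covariance is half the real part of a power sum with decreasing weights at most `2 ^ (-j)`, so
summation by parts gains `1 / ‖1 - ζ‖ ≤ 2 / |θ - θ'|`. Blocks finer than the separation of the
angles decorrelate geometrically. -/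
theorem abs_blockCov_le {r : ℝ} (hr : 0 ≤ r) (hr1 : r ≤ 1) {θ θ' : ℝ} (h0 : θ ≠ θ')
    (h1 : |θ - θ'| ≤ 1) (j : ℕ) : |blockCov r θ θ' j| ≤ 2 / (2 ^ j * |θ - θ'|) := by
  rw [blockCov_eq]
  set ζ := Complex.exp (((θ - θ' : ℝ) : ℂ) * Complex.I) with hζ
  have hpos : 0 < |θ - θ'| := abs_pos.2 (sub_ne_zero.2 h0)
  have h := norm_one_sub_mul_sum_le (w := fun k : ℕ => r ^ (2 * k) / k)
    (Complex.norm_exp_ofReal_mul_I (θ - θ')) (A := 2 ^ j) (B := 2 ^ (j + 1))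
    (Nat.pow_le_pow_right (by norm_num) (Nat.le_succ j)) (fun k _ => by positivity)
    (fun k hk => by
      have : (0 : ℝ) < k := by exact_mod_cast lt_of_lt_of_le (by positivity) hk
      have h3 : r ^ (2 * (k + 1)) ≤ r ^ (2 * k) := pow_le_pow_of_le_one hr hr1 (by omega)
      push_cast
      gcongr
      linarith)
  rw [← hζ, norm_mul] at h
  set S := ∑ k ∈ Finset.Ico ((2 : ℕ) ^ j) (2 ^ (j + 1)), ((r ^ (2 * k) / k : ℝ) : ℂ) * ζ ^ k
  have h2 := half_abs_le_norm_one_sub_exp h1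
  rw [← hζ] at h2
  have h4 : r ^ (2 * 2 ^ j) / ((2 ^ j : ℕ) : ℝ) ≤ 1 / 2 ^ j := by
    push_cast
    gcongr
    exact pow_le_one₀ hr hr1
  have h5 : |θ - θ'| / 2 * ‖S‖ ≤ 2 * (1 / 2 ^ j) :=
    (mul_le_mul_of_nonneg_right h2 (norm_nonneg _)).trans (h.trans (by linarith))
  rw [abs_div, abs_two, div_le_iff₀ (by norm_num)]
  refine (Complex.abs_re_le_norm S).trans ?_
  rw [div_mul_eq_mul_div, le_div_iff₀ (by positivity)]
  have e : (2 : ℝ) ^ j * (1 / 2 ^ j) = 1 := by field_simp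
  nlinarith [mul_le_mul_of_nonneg_left h5 (by positivity : (0 : ℝ) ≤ 2 ^ j)]

/-! ### Decoupling of two correlated Gaussian steps -/

/-- The affine function `y ↦ y + 3`, which is superharmonic for the killed walks. -/
noncomputable def height (y : ℝ) : ℝ≥0∞ := ENNReal.ofReal (y + 3)

@[fun_prop]
theorem measurable_height : Measurable height := by
  unfold height; fun_prop

/-- `height`, killed outside of `(0, ∞)`. -/
noncomputable def killedHeight : ℝ → ℝ≥0∞ := (Set.Ioi 0).indicator height

@[fun_prop]
theorem measurable_killedHeight : Measurable killedHeight :=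
  measurable_indicator_Ioi measurable_height

/-- Rotation by a quarter turn of a pair of independent Gaussians. -/
theorem lintegral_prod_gaussian_rotate (S : ℝ≥0) {f : ℝ × ℝ → ℝ≥0∞} (hf : Measurable f) :
    ∫⁻ u, ∫⁻ w, f (u + w, u - w) ∂gaussianReal 0 S ∂gaussianReal 0 S =
      ∫⁻ p, ∫⁻ q, f (p, q) ∂gaussianReal 0 (2 * S) ∂gaussianReal 0 (2 * S) := by
  obtain ⟨t, ht⟩ : ∃ t : ℝ, t ^ 2 = 2 * S := ⟨Real.sqrt (2 * S), Real.sq_sqrt (by positivity)⟩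
  set z : ℂ := (t : ℂ) with hz
  -- Both pairs are linear forms in one complex Gaussian: coefficients `z` and `z i` have variance
  -- `S`, while `z (1 ± i)` have variance `2S` and are again uncorrelated.
  have h1 := map_linForm_prod {0} (fun _ => z) (fun _ => z * Complex.I) (by simp [hz])
  have h2 := map_linForm_prod {0} (fun _ => z + z * Complex.I) (fun _ => z - z * Complex.I)
    (by simp [hz])
  have v1 : varForm {0} (fun _ => z) = S := by
    ext
    simp only [varForm, Finset.sum_singleton, NNReal.coe_div, NNReal.coe_pow, coe_nnnorm,
      Complex.sq_norm, Complex.normSq_apply, NNReal.coe_ofNat]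
    simp only [hz, Complex.ofReal_re, Complex.ofReal_im]
    nlinarith
  have v2 : varForm {0} (fun _ => z * Complex.I) = S := by
    ext
    simp only [varForm, Finset.sum_singleton, NNReal.coe_div, NNReal.coe_pow, coe_nnnorm,
      Complex.sq_norm, Complex.normSq_apply, NNReal.coe_ofNat]
    simp [hz]
    nlinarith
  have v3 : varForm {0} (fun _ => z + z * Complex.I) = 2 * S := by
    ext
    simp only [varForm, Finset.sum_singleton, NNReal.coe_div, NNReal.coe_pow, coe_nnnorm,
      Complex.sq_norm, Complex.normSq_apply, NNReal.coe_ofNat, NNReal.coe_mul]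
    simp [hz]
    nlinarith
  have v4 : varForm {0} (fun _ => z - z * Complex.I) = 2 * S := by
    ext
    simp only [varForm, Finset.sum_singleton, NNReal.coe_div, NNReal.coe_pow, coe_nnnorm,
      Complex.sq_norm, Complex.normSq_apply, NNReal.coe_ofNat, NNReal.coe_mul]
    simp [hz]
    nlinarith
  rw [v1, v2] at h1
  rw [v3, v4] at h2
  have hg : Measurable fun p : ℝ × ℝ => f (p.1 + p.2, p.1 - p.2) := by fun_prop
  rw [← lintegral_prod (fun p : ℝ × ℝ => f (p.1 + p.2, p.1 - p.2)) hg.aemeasurable,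
    ← lintegral_prod f hf.aemeasurable, ← h1, ← h2, lintegral_map hg (by fun_prop),
    lintegral_map hf (by fun_prop)]
  refine lintegral_congr fun x => ?_
  congr 2
  · simp only [linForm, Finset.sum_singleton, mul_add, Complex.add_re]
  · simp only [linForm, Finset.sum_singleton, mul_sub, Complex.sub_re]

theorem lintegral_gaussianReal_le {s s' : ℝ≥0} (hs : 0 < s) (hss : s ≤ s') (f : ℝ → ℝ≥0∞) :
    ∫⁻ g, f g ∂gaussianReal 0 s ≤
      ENNReal.ofReal (Real.sqrt (s' / s)) * ∫⁻ g, f g ∂gaussianReal 0 s' := by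
  refine (lintegral_mono' (gaussianReal_le_smul hs hss) le_rfl).trans (le_of_eq ?_)
  rw [lintegral_smul_measure, smul_eq_mul]

/-- Since `v - |c| ≥ v / 2 ≥ 1/16`, the ratio is at most `1 + 32 |c| ≤ exp (32 |c|)`, and the root
halves the exponent. -/
theorem sqrt_ratio_le {v c d : ℝ} (hv : 1 / 8 ≤ v) (hc : |c| ≤ v / 2) (hd : v - |c| ≤ 2 * d) :
    Real.sqrt ((v + |c|) / 2 / d) ≤ Real.exp (16 * |c|) := by
  have h0 := abs_nonneg c
  have hd0 : 0 < d := by linarith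
  rw [Real.sqrt_le_left (Real.exp_pos _).le, ← Real.exp_nat_mul]
  have := Real.add_one_le_exp (((2 : ℕ) : ℝ) * (16 * |c|))
  refine le_trans ?_ this
  rw [div_le_iff₀ hd0]
  push_cast
  nlinarith

/-- One step of the two-point function: if the covariance `c` of the two increments is small, then
the two killed walks evolve as if they were independent, at the cost of a factor `exp (40 |c|)`. -/
theorem two_point_step {v c x x' : ℝ} {s d : ℝ≥0} (hv : 1 / 8 ≤ v) (hv2 : v ≤ 1 / 2)
    (hc : |c| ≤ v / 2) (hs : (s : ℝ) = (v + c) / 2) (hd : (d : ℝ) = (v - c) / 2)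
    (hx : 0 ≤ x) (hx' : 0 ≤ x') :
    ∫⁻ u, ∫⁻ w, ENNReal.ofReal (Real.exp (4 * u - 4 * v)) *
        (killedHeight (x - (u + w - 2 * v)) * killedHeight (x' - (u - w - 2 * v)))
        ∂gaussianReal 0 d ∂gaussianReal 0 s ≤
      ENNReal.ofReal (Real.exp (40 * |c|)) * (height x * height x') := by
  have h0 := abs_nonneg c
  have hc1 := le_abs_self c
  have hc2 := neg_abs_le c
  -- The larger of the variances of half-sum and half-difference. Once both are raised to it, the
  -- sum and difference of the two become independent.
  let S : ℝ≥0 := ⟨(v + |c|) / 2, by linarith⟩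
  have hS : (S : ℝ) = (v + |c|) / 2 := rfl
  have hs0 : 0 < s := by
    have : (0 : ℝ) < s := by rw [hs]; linarith
    exact_mod_cast this
  have hd0 : 0 < d := by
    have : (0 : ℝ) < d := by rw [hd]; linarith
    exact_mod_cast this
  have hsS : s ≤ S := by
    have : (s : ℝ) ≤ S := by rw [hs, hS]; linarith
    exact_mod_cast this
  have hdS : d ≤ S := by
    have : (d : ℝ) ≤ S := by rw [hd, hS]; linarith
    exact_mod_cast this
  set f : ℝ × ℝ → ℝ≥0∞ := fun p => killedHeight (x - 2 * c - p.1) * killedHeight (x' - 2 * c - p.2)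
    with hf
  have hfm : Measurable f := by fun_prop
  let Ψ : ℝ → ℝ≥0∞ := fun u => ∫⁻ w,
    killedHeight (x - (u + w - 2 * v)) * killedHeight (x' - (u - w - 2 * v)) ∂gaussianReal 0 d
  have hΨ : Measurable Ψ := by
    refine Measurable.lintegral_prod_right' (f := fun p : ℝ × ℝ =>
      killedHeight (x - (p.1 + p.2 - 2 * v)) * killedHeight (x' - (p.1 - p.2 - 2 * v))) ?_
    fun_prop
  have e1 : ∀ u, ∫⁻ w, ENNReal.ofReal (Real.exp (4 * u - 4 * v)) *
        (killedHeight (x - (u + w - 2 * v)) * killedHeight (x' - (u - w - 2 * v)))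
        ∂gaussianReal 0 d = ENNReal.ofReal (Real.exp (-(4 * v))) *
          (ENNReal.ofReal (Real.exp (4 * u)) * Ψ u) := by
    intro u
    rw [lintegral_const_mul _ (by fun_prop), ← mul_assoc, ← ENNReal.ofReal_mul (by positivity),
      ← Real.exp_add]
    congr 3
    ring
  simp_rw [e1]
  rw [lintegral_const_mul _ (by fun_prop), lintegral_exp_mul_gaussianReal _ _ _ hΨ, ← mul_assoc,
    ← ENNReal.ofReal_mul (by positivity), ← Real.exp_add]
  -- Tilting by `4u` costs `exp (8s) = exp (4v + 4c)` and shifts `u` by `4s = 2v + 2c`. The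
  -- compensators absorb the terms in `v`, leaving a factor `exp (4c)` and a drift `2c` of each
  -- walk.
  have e2 : -(4 * v) + 4 ^ 2 * (s : ℝ) / 2 = 4 * c := by rw [hs]; ring
  have e3 : ∀ u, Ψ (u + 4 * s) = ∫⁻ w, f (u + w, u - w) ∂gaussianReal 0 d := by
    intro u
    simp only [Ψ, hf, hs]
    refine lintegral_congr fun w => ?_
    congr 2 <;> ring
  simp_rw [e2, e3]
  have e4 : ∫⁻ u, ∫⁻ w, f (u + w, u - w) ∂gaussianReal 0 d ∂gaussianReal 0 s ≤
      ENNReal.ofReal (Real.exp (16 * |c|)) * (ENNReal.ofReal (Real.exp (16 * |c|)) *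
        ∫⁻ u, ∫⁻ w, f (u + w, u - w) ∂gaussianReal 0 S ∂gaussianReal 0 S) := by
    refine (lintegral_gaussianReal_le hs0 hsS _).trans ?_
    refine mul_le_mul' (ENNReal.ofReal_le_ofReal ?_) ?_
    · exact sqrt_ratio_le hv hc (by rw [hs]; linarith)
    · rw [← lintegral_const_mul _ (Measurable.lintegral_prod_right'
        (f := fun p : ℝ × ℝ => f (p.1 + p.2, p.1 - p.2)) (by fun_prop))]
      refine lintegral_mono fun u => (lintegral_gaussianReal_le hd0 hdS _).trans ?_
      exact mul_le_mul' (ENNReal.ofReal_le_ofReal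
        (sqrt_ratio_le hv hc (by rw [hd]; linarith))) le_rfl
  have hk : ∀ x, 0 ≤ x → ∫⁻ p, killedHeight (x - 2 * c - p) ∂gaussianReal 0 (2 * S) ≤
      ENNReal.ofReal (Real.exp (2 * |c|)) * height x := by
    intro x hx
    have h1 : 0 < 2 * S := by
      have : 0 < S := hs0.trans_le hsS
      positivity
    have h2 : 2 * S ≤ 1 := by
      have : ((2 * S : ℝ≥0) : ℝ) ≤ 1 := by
        rw [NNReal.coe_mul, hS, NNReal.coe_ofNat]; linarith
      exact_mod_cast this
    have h3 := lintegral_gaussianReal_neg (2 * S) (fun p => killedHeight (x - 2 * c - p))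
      (by fun_prop)
    rw [← h3]
    have h4 := kill_affine_shift_le h1 h2 hx (-(2 * c))
    rw [abs_neg, abs_mul, abs_two] at h4
    simp only [sub_neg_eq_add]
    refine le_trans (le_trans (le_of_eq ?_) h4) (mul_le_mul' (ENNReal.ofReal_le_ofReal ?_) le_rfl)
    · simp only [kill, killedHeight, sub_eq_add_neg]
      rfl
    · linarith [Real.add_one_le_exp (2 * |c|)]
  rw [lintegral_prod_gaussian_rotate S hfm] at e4
  have e5 : ∫⁻ p, ∫⁻ q, f (p, q) ∂gaussianReal 0 (2 * S) ∂gaussianReal 0 (2 * S) ≤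
      (ENNReal.ofReal (Real.exp (2 * |c|)) * height x) *
      (ENNReal.ofReal (Real.exp (2 * |c|)) * height x') := by
    have : ∀ p, ∫⁻ q, f (p, q) ∂gaussianReal 0 (2 * S) =
        killedHeight (x - 2 * c - p) * ∫⁻ q, killedHeight (x' - 2 * c - q)
          ∂gaussianReal 0 (2 * S) := fun p =>
      lintegral_const_mul (killedHeight (x - 2 * c - p))
        (f := fun q => killedHeight (x' - 2 * c - q)) (by fun_prop)
    simp_rw [this]
    have hm : Measurable fun p => killedHeight (x - 2 * c - p) := by fun_prop
    rw [lintegral_mul_const _ hm]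
    exact mul_le_mul' (hk x hx) (hk x' hx')
  have e6 : ENNReal.ofReal (Real.exp (4 * c)) ≤ ENNReal.ofReal (Real.exp (4 * |c|)) :=
    ENNReal.ofReal_le_ofReal (Real.exp_le_exp.2 (by linarith))
  refine (mul_le_mul' e6 (e4.trans (mul_le_mul' le_rfl (mul_le_mul' le_rfl e5)))).trans
    (le_of_eq ?_)
  -- `40 = 4 + 16 + 16 + 2 + 2`: the tilt, the two changes of variance, and the drift of each walk.
  have e7 : ENNReal.ofReal (Real.exp (40 * |c|)) = ENNReal.ofReal (Real.exp (4 * |c|)) *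
      ENNReal.ofReal (Real.exp (16 * |c|)) * ENNReal.ofReal (Real.exp (16 * |c|)) *
      ENNReal.ofReal (Real.exp (2 * |c|)) * ENNReal.ofReal (Real.exp (2 * |c|)) := by
    simp only [← ENNReal.ofReal_mul (Real.exp_pos _).le, ← Real.exp_add]
    congr 2
    ring
  rw [e7]
  ring

/-! ### The killed walk and its weight -/

/-- The contribution of a dyadic block to `log |F|` at the point `r * exp (i θ)`. -/
noncomputable def blockSum (r : ℝ) (j : ℕ) (θ : ℝ) (x : ℕ → ℂ) : ℝ :=
  linForm (block j) (coef r θ) x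

/-- The distance of the walk to the barrier after `m` blocks, started at distance `a`. -/
noncomputable def pos (r a : ℝ) : ℕ → ℝ → (ℕ → ℂ) → ℝ
  | 0, _, _ => a
  | m + 1, θ, x => pos r a m θ x - (blockSum r m θ x - 2 * blockVar r m)

/-- The normalized value of `|F| ^ 2` on the event that the walk has not crossed the barrier. -/
noncomputable def wt (r a : ℝ) : ℕ → ℝ → (ℕ → ℂ) → ℝ≥0∞
  | 0, _, _ => 1
  | m + 1, θ, x => wt r a m θ x *
      ENNReal.ofReal (Real.exp (2 * blockSum r m θ x - 2 * blockVar r m)) *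
      (Set.Ioi 0).indicator 1 (pos r a (m + 1) θ x)

theorem measurable_coef (r : ℝ) (k : ℕ) : Measurable fun θ => coef r θ k := by
  unfold coef; fun_prop

theorem measurable_blockSum (r : ℝ) (j : ℕ) :
    Measurable fun p : ℝ × (ℕ → ℂ) => blockSum r j p.1 p.2 := by
  unfold blockSum linForm
  refine Finset.measurable_sum _ fun k _ => ?_
  have := measurable_coef r k
  fun_prop

theorem measurable_pos (r a : ℝ) (m : ℕ) :
    Measurable fun p : ℝ × (ℕ → ℂ) => pos r a m p.1 p.2 := by
  induction m with
  | zero => exact measurable_const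
  | succ m ih => exact ih.sub ((measurable_blockSum r m).sub measurable_const)

theorem measurable_wt (r a : ℝ) (m : ℕ) :
    Measurable fun p : ℝ × (ℕ → ℂ) => wt r a m p.1 p.2 := by
  induction m with
  | zero => exact measurable_const
  | succ m ih =>
    have h1 := measurable_blockSum r m
    have h2 := measurable_pos r a (m + 1)
    have h3 : Measurable ((Set.Ioi (0 : ℝ)).indicator (1 : ℝ → ℝ≥0∞)) :=
      measurable_indicator_Ioi measurable_one
    exact (ih.mul (by fun_prop)).mul (h3.comp h2)

theorem measurable_pos_right (r a : ℝ) (m : ℕ) (θ : ℝ) : Measurable (pos r a m θ) :=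
  (measurable_pos r a m).comp measurable_prodMk_left

theorem measurable_wt_right (r a : ℝ) (m : ℕ) (θ : ℝ) : Measurable (wt r a m θ) :=
  (measurable_wt r a m).comp measurable_prodMk_left

theorem measurable_blockSum_right (r : ℝ) (m : ℕ) (θ : ℝ) : Measurable (blockSum r m θ) :=
  measurable_linForm _ _

theorem blockSum_trunc {r : ℝ} {j : ℕ} {θ : ℝ} {t : Finset ℕ} (h : block j ⊆ t) (x : ℕ → ℂ) :
    blockSum r j θ (trunc t x) = blockSum r j θ x :=
  linForm_trunc h _ _

theorem block_subset_range {j m : ℕ} (h : j < m) : block j ⊆ Finset.range (2 ^ m) := by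
  intro k hk
  exact Finset.mem_range.2 ((Finset.mem_Ico.1 hk).2.trans_le
    (Nat.pow_le_pow_right (by norm_num) h))

theorem disjoint_range_block (m : ℕ) : Disjoint (Finset.range (2 ^ m)) (block m) := by
  rw [Finset.disjoint_left]
  intro k hk hk'
  exact absurd (Finset.mem_Ico.1 hk').1 (not_le.2 (Finset.mem_range.1 hk))

theorem pos_trunc (r a : ℝ) {m n : ℕ} (h : m ≤ n) (θ : ℝ) (x : ℕ → ℂ) :
    pos r a m θ (trunc (Finset.range (2 ^ n)) x) = pos r a m θ x := by
  induction m with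
  | zero => rfl
  | succ m ih => rw [pos, pos, ih (by omega), blockSum_trunc (block_subset_range h)]

theorem wt_trunc (r a : ℝ) {m n : ℕ} (h : m ≤ n) (θ : ℝ) (x : ℕ → ℂ) :
    wt r a m θ (trunc (Finset.range (2 ^ n)) x) = wt r a m θ x := by
  induction m with
  | zero => rfl
  | succ m ih =>
    rw [wt, wt, ih (by omega), blockSum_trunc (block_subset_range h), pos_trunc r a h]

theorem pos_of_wt_ne_zero {r a : ℝ} (ha : 0 < a) {m : ℕ} {θ : ℝ} {x : ℕ → ℂ}
    (h : wt r a m θ x ≠ 0) : 0 < pos r a m θ x := by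
  cases m with
  | zero => exact ha
  | succ m =>
    by_contra hn
    apply h
    rw [wt, Set.indicator_of_notMem (by simpa using hn), mul_zero]

theorem wt_mul_le_wt_mul {r a : ℝ} (ha : 0 < a) {m : ℕ} {θ : ℝ} {x : ℕ → ℂ} {f g : ℝ → ℝ≥0∞}
    (h : ∀ y, 0 < y → f y ≤ g y) :
    wt r a m θ x * f (pos r a m θ x) ≤ wt r a m θ x * g (pos r a m θ x) := by
  by_cases h0 : wt r a m θ x = 0
  · simp [h0]
  · exact mul_le_mul' le_rfl (h _ (pos_of_wt_ne_zero ha h0))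

theorem wt_succ_mul (r a : ℝ) (m : ℕ) (θ : ℝ) (x : ℕ → ℂ) (f : ℝ → ℝ≥0∞) :
    wt r a (m + 1) θ x * f (pos r a (m + 1) θ x) = wt r a m θ x *
      (ENNReal.ofReal (Real.exp (2 * blockSum r m θ x - 2 * blockVar r m)) *
      (Set.Ioi 0).indicator f
        (pos r a m θ x - (blockSum r m θ x - 2 * blockVar r m))) := by
  rw [wt, pos, mul_assoc, mul_assoc]
  congr 2
  simp only [Set.indicator]
  split_ifs <;> simp

/-- Markov property of the killed walk. -/
theorem lintegral_wt_succ {r a : ℝ} (hr : 0 ≤ r) (m : ℕ) (θ : ℝ) {f : ℝ → ℝ≥0∞}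
    (hf : Measurable f) :
    ∫⁻ x, wt r a (m + 1) θ x * f (pos r a (m + 1) θ x) ∂gaussSeq =
      ∫⁻ x, wt r a m θ x * kill (blockVar r m) f (pos r a m θ x) ∂gaussSeq := by
  have hfi := measurable_indicator_Ioi hf
  have hw := measurable_wt_right r a m θ
  have hp := measurable_pos_right r a m θ
  have hind : IndepFun (fun x => (wt r a m θ x, pos r a m θ x)) (blockSum r m θ) gaussSeq :=
    indepFun_of_trunc (disjoint_range_block m) (hw.prodMk hp) (measurable_blockSum_right r m θ)
      (fun x => by rw [wt_trunc r a le_rfl, pos_trunc r a le_rfl])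
      (fun x => blockSum_trunc le_rfl x)
  have h := lintegral_of_indepFun (hw.prodMk hp) (measurable_blockSum_right r m θ) hind
    (Φ := fun q : (ℝ≥0∞ × ℝ) × ℝ => q.1.1 *
      (ENNReal.ofReal (Real.exp (2 * q.2 - 2 * blockVar r m)) *
        (Set.Ioi 0).indicator f (q.1.2 - (q.2 - 2 * blockVar r m)))) (by fun_prop)
  simp only [wt_succ_mul]
  rw [h]
  have hlaw : gaussSeq.map (blockSum r m θ) = gaussianReal 0 (blockVar r m) := by
    rw [← varForm_coef hr θ, ← map_linForm]
    rfl
  rw [hlaw]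
  refine lintegral_congr fun x => ?_
  rw [lintegral_const_mul _ (by fun_prop)]
  congr 1
  set v := blockVar r m
  set y := pos r a m θ x
  have e1 : ∀ b : ℝ, ENNReal.ofReal (Real.exp (2 * b - 2 * v)) *
      (Set.Ioi 0).indicator f (y - (b - 2 * v)) = ENNReal.ofReal (Real.exp (-(2 * v))) *
        (ENNReal.ofReal (Real.exp (2 * b)) * (Set.Ioi 0).indicator f (y - (b - 2 * v))) := by
    intro b
    rw [← mul_assoc, ← ENNReal.ofReal_mul (by positivity), ← Real.exp_add]
    congr 3
    ring
  simp_rw [e1]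
  rw [lintegral_const_mul _ (by fun_prop),
    lintegral_exp_mul_gaussianReal v 2 (fun b => (Set.Ioi 0).indicator f (y - (b - 2 * v)))
      (by fun_prop), ← mul_assoc, ← ENNReal.ofReal_mul (by positivity), ← Real.exp_add]
  -- The normalization cancels the cost of the tilt by `2b`, and its shift `2v` cancels the
  -- compensator, so the weighted walk is centred.
  have e2 : -(2 * (v : ℝ)) + 2 ^ 2 * v / 2 = 0 := by ring
  rw [e2, Real.exp_zero, ENNReal.ofReal_one, one_mul, kill,
    ← lintegral_gaussianReal_neg v (fun g => (Set.Ioi 0).indicator f (y + g)) (by fun_prop)]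
  refine lintegral_congr fun g => ?_
  congr 1
  ring

/-- The expectation of a function of the killed walk after `m` blocks. -/
noncomputable def killIter (r : ℝ) : ℕ → (ℝ → ℝ≥0∞) → ℝ → ℝ≥0∞
  | 0, f => f
  | m + 1, f => killIter r m (kill (blockVar r m) f)

theorem lintegral_wt {r a : ℝ} (hr : 0 ≤ r) (m : ℕ) (θ : ℝ) {f : ℝ → ℝ≥0∞} (hf : Measurable f) :
    ∫⁻ x, wt r a m θ x * f (pos r a m θ x) ∂gaussSeq = killIter r m f a := by
  induction m generalizing f with
  | zero => simp [wt, pos, killIter]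
  | succ m ih => rw [lintegral_wt_succ hr m θ hf, ih (measurable_kill _ hf), killIter]

theorem killIter_mono {r a : ℝ} (hr : 0 ≤ r) (ha : 0 < a) (m : ℕ) {f g : ℝ → ℝ≥0∞}
    (hf : Measurable f) (hg : Measurable g) (h : ∀ y, 0 < y → f y ≤ g y) :
    killIter r m f a ≤ killIter r m g a := by
  rw [← lintegral_wt hr m 0 hf, ← lintegral_wt hr m 0 hg]
  exact lintegral_mono fun x => wt_mul_le_wt_mul ha h

theorem killIter_add_mul {r a : ℝ} (hr : 0 ≤ r) (m : ℕ) {f g : ℝ → ℝ≥0∞}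
    (hf : Measurable f) (hg : Measurable g) (c : ℝ≥0∞) :
    killIter r m (fun y => f y + c * g y) a = killIter r m f a + c * killIter r m g a := by
  have h1 := measurable_wt_right r a m 0
  have h2 := measurable_pos_right r a m 0
  rw [← lintegral_wt hr m 0 hf, ← lintegral_wt hr m 0 hg, ← lintegral_wt hr m 0 (by fun_prop),
    ← lintegral_const_mul _ (by fun_prop), ← lintegral_add_left (by fun_prop)]
  refine lintegral_congr fun x => ?_
  ring

/-- The exponential Green's function of the killed walk is bounded. -/
theorem sum_killIter_exp_le {r a : ℝ} (hr : 0 < r) (hr1 : r ≤ 1) {N : ℕ}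
    (hN : -Real.log r * 2 ^ N ≤ 1 / 4) (ha : 0 < a) :
    ∑ m ∈ Finset.range (N + 1), killIter r m (fun y => ENNReal.ofReal (Real.exp (-y))) a ≤ 64 := by
  set E : ℝ → ℝ≥0∞ := fun y => ENNReal.ofReal (Real.exp (-y)) with hE
  set G : ℝ → ℝ≥0∞ := fun y => ENNReal.ofReal (4 - Real.exp (-y)) with hG
  have hEm : Measurable E := by fun_prop
  have hGm : Measurable G := by fun_prop
  have hc : ENNReal.ofReal (1 / 16) ≤ 1 := ENNReal.ofReal_le_one.2 (by norm_num)
  -- The constant `1/16` is half the least block variance `1/8`, the guaranteed loss in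
  -- `kill_exp_le`.
  have hstep : ∀ m < N, killIter r (m + 1) G a + ENNReal.ofReal (1 / 16) * killIter r m E a ≤
      killIter r m G a := by
    intro m hm
    rw [killIter, ← killIter_add_mul hr.le m (measurable_kill _ hGm) hEm]
    have := measurable_kill (blockVar r m) hGm
    refine killIter_mono hr.le ha m (by fun_prop) hGm fun y hy => ?_
    have h1 := le_blockVar hr hN hm
    have h2 := blockVar_le hr.le hr1 m
    have hv : 0 < blockVar r m := by
      have : (0 : ℝ) < blockVar r m := by linarith
      exact_mod_cast this
    have hv1 : blockVar r m ≤ 1 := by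
      have : (blockVar r m : ℝ) ≤ 1 := by linarith
      exact_mod_cast this
    refine le_trans (add_le_add le_rfl ?_) (kill_exp_le hv hv1 hy.le)
    rw [hE, ← ENNReal.ofReal_mul (by norm_num)]
    refine ENNReal.ofReal_le_ofReal ?_
    exact mul_le_mul_of_nonneg_right (by linarith) (Real.exp_pos _).le
  have hsum : ∀ m ≤ N, killIter r m G a +
      ENNReal.ofReal (1 / 16) * ∑ i ∈ Finset.range m, killIter r i E a ≤ 4 := by
    intro m hm
    induction m with
    | zero =>
      simp only [killIter, Finset.range_zero, Finset.sum_empty, mul_zero, add_zero, hG]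
      refine (ENNReal.ofReal_le_ofReal (q := 4) ?_).trans (by simp)
      linarith [Real.exp_pos (-a)]
    | succ m ih =>
      rw [Finset.sum_range_succ, mul_add]
      calc _ = killIter r (m + 1) G a + ENNReal.ofReal (1 / 16) * killIter r m E a +
            ENNReal.ofReal (1 / 16) * ∑ i ∈ Finset.range m, killIter r i E a := by ring
        _ ≤ _ := add_le_add (hstep m hm) le_rfl
        _ ≤ 4 := ih (by omega)
  -- Block `N` has no lower variance bound, so the last term of the sum is compared with `G`
  -- directly, using `exp (-y) ≤ 4 - exp (-y)`.
  have hlast : ENNReal.ofReal (1 / 16) * killIter r N E a ≤ killIter r N G a := by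
    refine (mul_le_of_le_one_left zero_le hc).trans
      (killIter_mono hr.le ha N hEm hGm fun y hy => ENNReal.ofReal_le_ofReal ?_)
    have : Real.exp (-y) ≤ 1 := Real.exp_le_one_iff.2 (by linarith)
    linarith
  have hfin : ENNReal.ofReal (1 / 16) * ∑ i ∈ Finset.range (N + 1), killIter r i E a ≤ 4 := by
    rw [Finset.sum_range_succ, mul_add, add_comm]
    exact (add_le_add hlast le_rfl).trans (hsum N le_rfl)
  have e : ENNReal.ofReal 16 * ENNReal.ofReal (1 / 16) = 1 := by
    rw [← ENNReal.ofReal_mul (by norm_num)]; norm_num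
  calc _ = ENNReal.ofReal 16 * (ENNReal.ofReal (1 / 16) *
        ∑ i ∈ Finset.range (N + 1), killIter r i E a) := by rw [← mul_assoc, e, one_mul]
    _ ≤ ENNReal.ofReal 16 * 4 := mul_le_mul' le_rfl hfin
    _ = 64 := by rw [ENNReal.ofReal_ofNat]; norm_num

/-- Lower bound for the probability that the walk stays away from the barrier. -/
theorem reflectGap_le_killIter {r a : ℝ} (hr : 0 ≤ r) (ha : 0 < a) (y : ℝ) (m : ℕ) (s : ℝ≥0) :
    ENNReal.ofReal (reflectGap y (s + ∑ j ∈ Finset.range m, blockVar r j) a) ≤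
      killIter r m (fun z => ENNReal.ofReal (reflectGap y s z)) a := by
  induction m generalizing s with
  | zero => simp [killIter]
  | succ m ih =>
    rw [killIter, Finset.sum_range_succ, add_comm _ (blockVar r m), ← add_assoc]
    have hm := measurable_reflectGap y
    refine (ih (s + blockVar r m)).trans (killIter_mono hr ha m
      (hm _).ennreal_ofReal (measurable_kill _ (hm _).ennreal_ofReal) fun z _ => ?_)
    exact reflectGap_le_kill y s (blockVar r m) z

theorem le_killIter_indicator {r a : ℝ} (hr : 0 < r) (hr1 : r ≤ 1) {N : ℕ} (hN1 : 1 ≤ N)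
    (hN : -Real.log r * 2 ^ N ≤ 1 / 4) (ha : 0 < a) (haN : a ≤ Real.sqrt N) :
    ENNReal.ofReal (Real.exp (-16) * (a / Real.sqrt N)) ≤
      killIter r N ((Set.Ici (Real.sqrt N)).indicator 1) a := by
  have h := reflectGap_le_killIter hr.le ha (Real.sqrt N) N 0
  rw [zero_add] at h
  refine le_trans (ENNReal.ofReal_le_ofReal (le_reflectGap (by exact_mod_cast hN1) ha haN ?_ ?_))
    (h.trans (killIter_mono hr.le ha N (measurable_reflectGap _ _).ennreal_ofReal
      (Measurable.indicator measurable_one measurableSet_Ici)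
      fun y _ => ofReal_reflectGap_zero_le y))
  · rw [NNReal.coe_sum]
    have := Finset.card_nsmul_le_sum (Finset.range N) (fun j => (blockVar r j : ℝ)) (1 / 8)
      fun j hj => le_blockVar hr hN (Finset.mem_range.1 hj)
    rw [Finset.card_range, nsmul_eq_mul] at this
    linarith
  · rw [NNReal.coe_sum]
    have := Finset.sum_le_card_nsmul (Finset.range N) (fun j => (blockVar r j : ℝ)) (1 / 2)
      fun j hj => blockVar_le hr.le hr1 j
    rw [Finset.card_range, nsmul_eq_mul] at this
    linarith

/-! ### The two-point function -/

/-- The two-point function of the killed and weighted walks. -/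
noncomputable def twoPoint (r a : ℝ) (m : ℕ) (θ θ' : ℝ) : ℝ≥0∞ :=
  ∫⁻ x, (wt r a m θ x * height (pos r a m θ x)) * (wt r a m θ' x * height (pos r a m θ' x))
    ∂gaussSeq

theorem coe_varForm_half_add (s : Finset ℕ) (b d : ℕ → ℂ) :
    (varForm s (fun k => (b k + d k) / 2) : ℝ) = (varForm s b + varForm s d) / 4 +
      (∑ k ∈ s, ((b k).re * (d k).re + (b k).im * (d k).im) / 2) / 2 := by
  simp only [varForm, NNReal.coe_sum, NNReal.coe_div, NNReal.coe_pow, coe_nnnorm,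
    ← Finset.sum_add_distrib, Complex.sq_norm, Complex.normSq_apply, Finset.sum_div]
  refine Finset.sum_congr rfl fun k _ => ?_
  simp only [NNReal.coe_ofNat, Complex.div_ofNat_re, Complex.div_ofNat_im, Complex.add_re,
    Complex.add_im]
  ring

theorem coe_varForm_half_sub (s : Finset ℕ) (b d : ℕ → ℂ) :
    (varForm s (fun k => (b k - d k) / 2) : ℝ) = (varForm s b + varForm s d) / 4 -
      (∑ k ∈ s, ((b k).re * (d k).re + (b k).im * (d k).im) / 2) / 2 := by
  simp only [varForm, NNReal.coe_sum, NNReal.coe_div, NNReal.coe_pow, coe_nnnorm,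
    ← Finset.sum_add_distrib, ← Finset.sum_sub_distrib, Complex.sq_norm, Complex.normSq_apply,
    Finset.sum_div]
  refine Finset.sum_congr rfl fun k _ => ?_
  simp only [NNReal.coe_ofNat, Complex.div_ofNat_re, Complex.div_ofNat_im, Complex.sub_re,
    Complex.sub_im]
  ring

/-- The two increments are `u + w` and `u - w`. Since the block variance does not depend on the
angle, `u` and `w` are uncorrelated, hence independent, and they are independent of earlier blocks.
`two_point_step` then applies with both current positions frozen. -/
theorem twoPoint_succ_le {r a : ℝ} (hr : 0 < r) (hr1 : r ≤ 1) {N m : ℕ}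
    (hN : -Real.log r * 2 ^ N ≤ 1 / 4) (ha : 0 < a) (hm : m < N) {θ θ' : ℝ}
    (hc : |blockCov r θ θ' m| ≤ 1 / 16) :
    twoPoint r a (m + 1) θ θ' ≤
      ENNReal.ofReal (Real.exp (40 * |blockCov r θ θ' m|)) * twoPoint r a m θ θ' := by
  set b := coef r θ
  set d := coef r θ'
  set v : ℝ := ((blockVar r m : ℝ≥0) : ℝ) with hv
  have hv1 : 1 / 8 ≤ v := le_blockVar hr hN hm
  have hv2 : v ≤ 1 / 2 := blockVar_le hr.le hr1 m
  set u : (ℕ → ℂ) → ℝ := linForm (block m) (fun k => (b k + d k) / 2)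
  set w : (ℕ → ℂ) → ℝ := linForm (block m) (fun k => (b k - d k) / 2)
  have hum : Measurable u := measurable_linForm _ _
  have hwm : Measurable w := measurable_linForm _ _
  have hbv : (varForm (block m) b : ℝ) = v := by rw [varForm_coef hr.le]
  have hdv : (varForm (block m) d : ℝ) = v := by rw [varForm_coef hr.le]
  have e1 : ∀ x, blockSum r m θ x = u x + w x := by
    intro x
    simp only [blockSum, u, w, linForm, ← Finset.sum_add_distrib, ← Complex.add_re, ← mul_add]
    refine Finset.sum_congr rfl fun k _ => ?_
    congr 2
    ring
  have e2 : ∀ x, blockSum r m θ' x = u x - w x := by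
    intro x
    simp only [blockSum, u, w, linForm, ← Finset.sum_sub_distrib, ← Complex.sub_re, ← mul_sub]
    refine Finset.sum_congr rfl fun k _ => ?_
    congr 2
    ring
  have hlaw := map_linForm_prod (block m) (fun k => (b k + d k) / 2) (fun k => (b k - d k) / 2) (by
    have : (varForm (block m) b : ℝ) - varForm (block m) d = 0 := by rw [hbv, hdv, sub_self]
    simp only [varForm, NNReal.coe_sum, NNReal.coe_div, NNReal.coe_pow, coe_nnnorm,
      ← Finset.sum_sub_distrib, Complex.sq_norm, Complex.normSq_apply] at this
    refine Eq.trans ?_ ((congrArg (fun t => (1 / 2 : ℝ) * t) this).trans (mul_zero _))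
    rw [Finset.mul_sum]
    refine Finset.sum_congr rfl fun k _ => ?_
    simp only [NNReal.coe_ofNat, Complex.div_ofNat_re, Complex.div_ofNat_im, Complex.sub_re,
      Complex.sub_im, Complex.add_re, Complex.add_im]
    ring)
  have hs := coe_varForm_half_add (block m) b d
  have hd := coe_varForm_half_sub (block m) b d
  change _ = _ + blockCov r θ θ' m / 2 at hs
  change _ = _ - blockCov r θ θ' m / 2 at hd
  rw [hbv, hdv] at hs hd
  set c := blockCov r θ θ' m
  have hp : ∀ θ, Measurable fun x => (wt r a m θ x, pos r a m θ x) := fun θ =>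
    (measurable_wt_right r a m θ).prodMk (measurable_pos_right r a m θ)
  have hpt : ∀ θ x, (wt r a m θ (trunc (Finset.range (2 ^ m)) x),
      pos r a m θ (trunc (Finset.range (2 ^ m)) x)) = (wt r a m θ x, pos r a m θ x) := fun θ x => by
    rw [wt_trunc r a le_rfl, pos_trunc r a le_rfl]
  have hind : IndepFun (fun x => ((wt r a m θ x, pos r a m θ x), (wt r a m θ' x, pos r a m θ' x)))
      (fun x => (u x, w x)) gaussSeq :=
    indepFun_of_trunc (disjoint_range_block m) ((hp θ).prodMk (hp θ')) (hum.prodMk hwm)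
      (fun x => by rw [hpt, hpt])
      (fun x => congrArg₂ Prod.mk (linForm_trunc le_rfl _ x) (linForm_trunc le_rfl _ x))
  have h := lintegral_of_indepFun ((hp θ).prodMk (hp θ')) (hum.prodMk hwm) hind
    (Φ := fun q : ((ℝ≥0∞ × ℝ) × (ℝ≥0∞ × ℝ)) × (ℝ × ℝ) => q.1.1.1 * q.1.2.1 *
      (ENNReal.ofReal (Real.exp (4 * q.2.1 - 4 * v)) *
        (killedHeight (q.1.1.2 - (q.2.1 + q.2.2 - 2 * v)) *
          killedHeight (q.1.2.2 - (q.2.1 - q.2.2 - 2 * v))))) (by fun_prop)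
  have e3 : twoPoint r a (m + 1) θ θ' = ∫⁻ x, wt r a m θ x * wt r a m θ' x *
      (ENNReal.ofReal (Real.exp (4 * u x - 4 * v)) *
        (killedHeight (pos r a m θ x - (u x + w x - 2 * v)) *
          killedHeight (pos r a m θ' x - (u x - w x - 2 * v)))) ∂gaussSeq := by
    refine lintegral_congr fun x => ?_
    rw [wt_succ_mul, wt_succ_mul, e1, e2, ← hv]
    have : ENNReal.ofReal (Real.exp (4 * u x - 4 * v)) =
        ENNReal.ofReal (Real.exp (2 * (u x + w x) - 2 * v)) *
        ENNReal.ofReal (Real.exp (2 * (u x - w x) - 2 * v)) := by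
      rw [← ENNReal.ofReal_mul (by positivity), ← Real.exp_add]
      congr 2
      ring
    rw [this]
    simp only [killedHeight]
    ring
  rw [e3, h, hlaw, twoPoint, ← lintegral_const_mul']
  swap
  · exact ENNReal.ofReal_ne_top
  refine lintegral_mono fun x => ?_
  dsimp only
  rw [lintegral_const_mul _ (by fun_prop), lintegral_prod _ (by fun_prop)]
  by_cases h1 : wt r a m θ x = 0
  · simp [h1]
  by_cases h2 : wt r a m θ' x = 0
  · simp [h2]
  have h3 := two_point_step (c := c) hv1 hv2 (by linarith) (by rw [hs]; ring) (by rw [hd]; ring)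
    (pos_of_wt_ne_zero ha h1).le (pos_of_wt_ne_zero ha h2).le
  refine (mul_le_mul' le_rfl h3).trans (le_of_eq ?_)
  ring

/-- Decoupling of the two walks beyond the scale of their separation. -/
theorem twoPoint_le_of_scale {r a : ℝ} (hr : 0 < r) (hr1 : r ≤ 1) {N m : ℕ}
    (hN : -Real.log r * 2 ^ N ≤ 1 / 4) (ha : 0 < a) (hm : m ≤ N) {θ θ' : ℝ}
    (h1 : |θ - θ'| ≤ 1) (hs : m < N → 32 ≤ 2 ^ m * |θ - θ'|) :
    twoPoint r a N θ θ' ≤ ENNReal.ofReal (Real.exp 5) * twoPoint r a m θ θ' := by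
  -- The threshold `32` gives covariance at most `2 ^ (m - n) / 16` in block `n`. Its cost `40 / 16
  -- * 2 ^ (m - n)` is exactly the increase of `5 - 5 * 2 ^ (m - n)` from `n` to `n + 1`.
  have key : ∀ n, m ≤ n → n ≤ N → twoPoint r a n θ θ' ≤
      ENNReal.ofReal (Real.exp (5 - 5 * (2 ^ m / 2 ^ n))) * twoPoint r a m θ θ' := by
    intro n hmn
    induction n, hmn using Nat.le_induction with
    | base =>
      intro _
      rw [div_self (by positivity)]
      simp
    | succ n hmn ih =>
      intro hn
      have hs' := hs (by omega)
      have hpos : 0 < |θ - θ'| := by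
        by_contra h0
        have : |θ - θ'| = 0 := le_antisymm (not_lt.1 h0) (abs_nonneg _)
        rw [this] at hs'
        norm_num at hs'
      have hc : |blockCov r θ θ' n| ≤ 1 / 16 * (2 ^ m / 2 ^ n) := by
        refine (abs_blockCov_le hr.le hr1 (sub_ne_zero.1 (abs_pos.1 hpos)) h1 n).trans ?_
        have h2n : (0 : ℝ) < 2 ^ n := by positivity
        rw [div_le_iff₀ (by positivity)]
        field_simp
        linarith
      have h2 : (2 : ℝ) ^ m / 2 ^ n ≤ 1 :=
        (div_le_one (by positivity)).2 (pow_le_pow_right₀ (by norm_num) hmn)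
      refine (twoPoint_succ_le hr hr1 hN ha (by omega) (by linarith)).trans ?_
      refine (mul_le_mul' le_rfl (ih (by omega))).trans ?_
      rw [← mul_assoc, ← ENNReal.ofReal_mul (by positivity), ← Real.exp_add]
      refine mul_le_mul' (ENNReal.ofReal_le_ofReal (Real.exp_le_exp.2 ?_)) le_rfl
      rw [pow_succ, ← div_div]
      linarith
  refine (key N hm le_rfl).trans (mul_le_mul' (ENNReal.ofReal_le_ofReal (Real.exp_le_exp.2 ?_)) le_rfl)
  have : (0 : ℝ) ≤ 2 ^ m / 2 ^ N := by positivity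
  linarith

/-- Without its indicators the weight telescopes to this exponential. At surviving points, where
`pos` is positive, the barrier therefore caps it. -/
theorem wt_le (r a : ℝ) (m : ℕ) (θ : ℝ) (x : ℕ → ℂ) :
    wt r a m θ x ≤ ENNReal.ofReal (Real.exp (2 * a + logSecond r m - 2 * pos r a m θ x)) := by
  induction m with
  | zero => simp [wt, pos, logSecond]
  | succ m ih =>
    rw [wt]
    have h1 : (Set.Ioi (0 : ℝ)).indicator (1 : ℝ → ℝ≥0∞) (pos r a (m + 1) θ x) ≤ 1 :=
      Set.indicator_le_self' (fun _ _ => zero_le) _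
    refine (mul_le_mul' (mul_le_mul' ih le_rfl) h1).trans (le_of_eq ?_)
    rw [mul_one, ← ENNReal.ofReal_mul (by positivity), ← Real.exp_add]
    congr 2
    rw [pos, logSecond, logSecond, Finset.sum_range_succ]
    ring

/-- One factor of the weight is kept to drive the killed walk and the other is bounded by `wt_le`.
Half of its decay `exp (-2y)` absorbs the heights, since `(y + 3)² ≤ 9 exp y`. -/
theorem sq_wt_mul_height_le {r a : ℝ} (ha : 0 < a) (m : ℕ) (θ : ℝ) (x : ℕ → ℂ) :
    (wt r a m θ x * height (pos r a m θ x)) * (wt r a m θ x * height (pos r a m θ x)) ≤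
      ENNReal.ofReal (9 * Real.exp (2 * a + logSecond r m)) *
        (wt r a m θ x * ENNReal.ofReal (Real.exp (-pos r a m θ x))) := by
  by_cases h0 : wt r a m θ x = 0
  · simp [h0]
  have hp := pos_of_wt_ne_zero ha h0
  set y := pos r a m θ x
  calc _ = wt r a m θ x * (wt r a m θ x * (height y * height y)) := by ring
    _ ≤ wt r a m θ x * (ENNReal.ofReal (Real.exp (2 * a + logSecond r m - 2 * y)) *
        (height y * height y)) := mul_le_mul' le_rfl (mul_le_mul' (wt_le r a m θ x) le_rfl)
    _ ≤ wt r a m θ x * (ENNReal.ofReal (9 * Real.exp (2 * a + logSecond r m)) *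
        ENNReal.ofReal (Real.exp (-y))) := by
      refine mul_le_mul' le_rfl ?_
      rw [height, ← ENNReal.ofReal_mul (by positivity), ← ENNReal.ofReal_mul (by positivity),
        ← ENNReal.ofReal_mul (by positivity)]
      refine ENNReal.ofReal_le_ofReal ?_
      have e1 : Real.exp (2 * a + logSecond r m - 2 * y) =
          Real.exp (2 * a + logSecond r m) * Real.exp (-y) * Real.exp (-y) := by
        rw [← Real.exp_add, ← Real.exp_add]
        congr 1
        ring
      have e2 : Real.exp (-y) * ((y + 3) * (y + 3)) ≤ 9 := by
        rw [Real.exp_neg, inv_mul_le_iff₀ (Real.exp_pos _)]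
        nlinarith [Real.quadratic_le_exp_of_nonneg hp.le]
      rw [e1]
      have : 0 ≤ Real.exp (2 * a + logSecond r m) * Real.exp (-y) := by positivity
      nlinarith [mul_le_mul_of_nonneg_left e2 this]
    _ = _ := by ring

theorem mul_le_sq_add_sq (a b : ℝ≥0∞) : a * b ≤ a * a + b * b := by
  rcases le_total a b with h | h
  · exact (mul_le_mul' h le_rfl).trans le_add_self
  · exact (mul_le_mul' le_rfl h).trans le_self_add

/-- Above the scale of their separation the two points are not distinguished: `ab ≤ a² + b²` reduces
to one point. Here `54 = 2 * 9 * 3`. -/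
theorem twoPoint_le_killIter {r a : ℝ} (hr : 0 ≤ r) (hr1 : r ≤ 1) (ha : 0 < a) (m : ℕ)
    (θ θ' : ℝ) : twoPoint r a m θ θ' ≤ ENNReal.ofReal (54 * Real.exp (2 * a) * 2 ^ m) *
      killIter r m (fun y => ENNReal.ofReal (Real.exp (-y))) a := by
  set E : ℝ → ℝ≥0∞ := fun y => ENNReal.ofReal (Real.exp (-y)) with hE
  set K := ENNReal.ofReal (9 * Real.exp (2 * a + logSecond r m))
  have hEm : Measurable E := by fun_prop
  have hm : ∀ θ, Measurable fun x => K * (wt r a m θ x * E (pos r a m θ x)) := by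
    intro θ
    have := measurable_wt_right r a m θ
    have := measurable_pos_right r a m θ
    fun_prop
  have h1 : twoPoint r a m θ θ' ≤ K * killIter r m E a + K * killIter r m E a := by
    refine (lintegral_mono fun x => (mul_le_sq_add_sq _ _).trans
      (add_le_add (sq_wt_mul_height_le ha m θ x) (sq_wt_mul_height_le ha m θ' x))).trans ?_
    rw [lintegral_add_left (hm θ), lintegral_const_mul' _ _ ENNReal.ofReal_ne_top,
      lintegral_const_mul' _ _ ENNReal.ofReal_ne_top]
    exact (congrArg₂ (fun p q => K * p + K * q) (lintegral_wt hr m θ hEm)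
      (lintegral_wt hr m θ' hEm)).le
  refine h1.trans ?_
  rw [← add_mul, ← ENNReal.ofReal_add (by positivity) (by positivity)]
  refine mul_le_mul' (ENNReal.ofReal_le_ofReal ?_) le_rfl
  rw [Real.exp_add]
  have := exp_logSecond_le hr hr1 m
  nlinarith [mul_le_mul_of_nonneg_left this (Real.exp_pos (2 * a)).le]

/-! ### Moments of the truncated mass -/

/-- The normalized mass of the points of `[0, 1]` at which the walk has not crossed the barrier and
ends at distance at least `√N` from it. -/
noncomputable def mass (r a : ℝ) (N : ℕ) (x : ℕ → ℂ) : ℝ≥0∞ :=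
  ∫⁻ θ in Set.Icc (0 : ℝ) 1, wt r a N θ x * (Set.Ici (Real.sqrt N)).indicator 1 (pos r a N θ x)

/-- The truncated derivative martingale. -/
noncomputable def derivMass (r a : ℝ) (N : ℕ) (x : ℕ → ℂ) : ℝ≥0∞ :=
  ∫⁻ θ in Set.Icc (0 : ℝ) 1, wt r a N θ x * height (pos r a N θ x)

theorem measurable_wt_mul {r a : ℝ} {N : ℕ} {f : ℝ → ℝ≥0∞} (hf : Measurable f) :
    Measurable fun p : ℝ × (ℕ → ℂ) => wt r a N p.1 p.2 * f (pos r a N p.1 p.2) :=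
  (measurable_wt r a N).mul (hf.comp (measurable_pos r a N))

theorem measurable_indicator_Ici_one (y : ℝ) :
    Measurable ((Set.Ici y).indicator (1 : ℝ → ℝ≥0∞)) :=
  Measurable.indicator measurable_one measurableSet_Ici

theorem measurable_mass (r a : ℝ) (N : ℕ) : Measurable (mass r a N) :=
  (measurable_wt_mul (measurable_indicator_Ici_one _)).lintegral_prod_left'

theorem measurable_derivMass (r a : ℝ) (N : ℕ) : Measurable (derivMass r a N) :=
  (measurable_wt_mul measurable_height).lintegral_prod_left'

theorem le_lintegral_mass {r a : ℝ} (hr : 0 < r) (hr1 : r ≤ 1) {N : ℕ} (hN1 : 1 ≤ N)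
    (hN : -Real.log r * 2 ^ N ≤ 1 / 4) (ha : 0 < a) (haN : a ≤ Real.sqrt N) :
    ENNReal.ofReal (Real.exp (-16) * (a / Real.sqrt N)) ≤ ∫⁻ x, mass r a N x ∂gaussSeq := by
  have hm := measurable_wt_mul (r := r) (a := a) (N := N)
    (measurable_indicator_Ici_one (Real.sqrt N))
  unfold mass
  rw [lintegral_lintegral_swap]
  swap
  · exact (hm.comp measurable_swap).aemeasurable
  simp_rw [lintegral_wt hr.le N _ (measurable_indicator_Ici_one (Real.sqrt N))]
  rw [setLIntegral_const, Real.volume_Icc]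
  simpa using le_killIter_indicator hr hr1 hN1 hN ha haN

/-- The terminal condition makes the height at least `√N`. Trading the indicator for the
superharmonic height gains `1 / √N` and leaves a quantity with second moment bounded uniformly in
`N`. -/
theorem mass_le_derivMass {r a : ℝ} {N : ℕ} (hN1 : 1 ≤ N) (x : ℕ → ℂ) :
    mass r a N x ≤ ENNReal.ofReal (Real.sqrt N)⁻¹ * derivMass r a N x := by
  have hs : 0 < Real.sqrt N := Real.sqrt_pos.2 (by exact_mod_cast hN1)
  unfold mass derivMass
  rw [← lintegral_const_mul' _ _ ENNReal.ofReal_ne_top]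
  refine lintegral_mono fun θ => ?_
  rw [mul_left_comm]
  refine mul_le_mul' le_rfl ?_
  simp only [Set.indicator, Set.mem_Ici]
  split_ifs with h
  · rw [height, ← ENNReal.ofReal_mul (by positivity), Pi.one_apply, ENNReal.one_le_ofReal,
      inv_mul_eq_div, one_le_div hs]
    linarith
  · exact zero_le

/-- Take the least `m ≤ N` with `2 ^ m t ≥ 32`; minimality bounds `2 ^ m t` by `64`. If there is
none, `m = N` works, as no block is left to decouple. -/
theorem exists_scale {N : ℕ} {t : ℝ} (ht1 : t ≤ 1) :
    ∃ m ≤ N, t ≤ 64 / 2 ^ m ∧ (m < N → 32 ≤ 2 ^ m * t) := by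
  classical
  by_cases h : ∃ m, m ≤ N ∧ 32 ≤ 2 ^ m * t
  · obtain ⟨h1, h2⟩ := Nat.find_spec h
    refine ⟨Nat.find h, h1, ?_, fun _ => h2⟩
    rw [le_div_iff₀ (by positivity)]
    cases hm : Nat.find h with
    | zero => norm_num; linarith
    | succ m =>
      have h3 := Nat.find_min h (show m < Nat.find h by omega)
      have h4 : ¬ 32 ≤ 2 ^ m * t := fun h5 => h3 ⟨by omega, h5⟩
      rw [pow_succ]
      linarith
  · push Not at h
    refine ⟨N, le_rfl, ?_, fun h => absurd h (lt_irrefl _)⟩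
    rw [le_div_iff₀ (by positivity)]
    linarith [h N le_rfl]

/-- Summing over all scales with indicators avoids choosing the scale as a function of the angles,
and can be integrated term by term. -/
theorem twoPoint_le_sum {r a : ℝ} (hr : 0 < r) (hr1 : r ≤ 1) {N : ℕ}
    (hN : -Real.log r * 2 ^ N ≤ 1 / 4) (ha : 0 < a) {θ θ' : ℝ} (h1 : |θ - θ'| ≤ 1) :
    twoPoint r a N θ θ' ≤ ∑ m ∈ Finset.range (N + 1),
      (Metric.closedBall θ (64 / 2 ^ m)).indicator 1 θ' *
        (ENNReal.ofReal (Real.exp 5) * (ENNReal.ofReal (54 * Real.exp (2 * a) * 2 ^ m) *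
          killIter r m (fun y => ENNReal.ofReal (Real.exp (-y))) a)) := by
  obtain ⟨m, hm, h2, h3⟩ := exists_scale (N := N) h1
  have hmem : θ' ∈ Metric.closedBall θ (64 / 2 ^ m) := by
    rw [Metric.mem_closedBall, Real.dist_eq, abs_sub_comm]
    exact h2
  refine le_trans ?_ (Finset.single_le_sum (f := fun m =>
    (Metric.closedBall θ (64 / 2 ^ m)).indicator (1 : ℝ → ℝ≥0∞) θ' *
        (ENNReal.ofReal (Real.exp 5) * (ENNReal.ofReal (54 * Real.exp (2 * a) * 2 ^ m) *
          killIter r m (fun y => ENNReal.ofReal (Real.exp (-y))) a)))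
    (fun _ _ => zero_le) (Finset.mem_range.2 (Nat.lt_succ_of_le hm)))
  simp only [Set.indicator_of_mem hmem, Pi.one_apply, one_mul]
  exact (twoPoint_le_of_scale hr hr1 hN ha hm h1 h3).trans
    (mul_le_mul' le_rfl (twoPoint_le_killIter hr.le hr1 ha m θ θ'))

/-- After Fubini, the length `128 / 2 ^ m` of the ball cancels the growth `2 ^ m` of the two-point
bound, leaving the bounded Green's function. The constants are `128 * 54 = 6912` and `6912 * 64 =
442368`. -/
theorem lintegral_sq_derivMass_le {r a : ℝ} (hr : 0 < r) (hr1 : r ≤ 1) {N : ℕ}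
    (hN : -Real.log r * 2 ^ N ≤ 1 / 4) (ha : 0 < a) :
    ∫⁻ x, derivMass r a N x * derivMass r a N x ∂gaussSeq ≤
      ENNReal.ofReal (442368 * Real.exp 5 * Real.exp (2 * a)) := by
  set f : ℝ → (ℕ → ℂ) → ℝ≥0∞ := fun θ x => wt r a N θ x * height (pos r a N θ x)
  have hm : Measurable fun p : ℝ × (ℕ → ℂ) => f p.1 p.2 := measurable_wt_mul measurable_height
  have hm1 : ∀ x, Measurable fun θ => f θ x := fun x => hm.comp measurable_prodMk_right
  have hm2 : ∀ θ, Measurable fun x => f θ x := fun θ => hm.comp measurable_prodMk_left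
  have hD := measurable_derivMass r a N
  have e1 : ∫⁻ x, derivMass r a N x * derivMass r a N x ∂gaussSeq =
      ∫⁻ θ in Set.Icc (0 : ℝ) 1, ∫⁻ θ' in Set.Icc (0 : ℝ) 1, twoPoint r a N θ θ' := by
    have : ∀ x, derivMass r a N x * derivMass r a N x =
        ∫⁻ θ in Set.Icc (0 : ℝ) 1, f θ x * derivMass r a N x := fun x =>
      (lintegral_mul_const _ (hm1 x)).symm
    simp_rw [this]
    rw [lintegral_lintegral_swap]
    swap
    · exact ((hm.comp measurable_swap).mul (hD.comp measurable_fst)).aemeasurable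
    refine lintegral_congr fun θ => ?_
    have : ∀ x, f θ x * derivMass r a N x =
        ∫⁻ θ' in Set.Icc (0 : ℝ) 1, f θ x * f θ' x := fun x =>
      (lintegral_const_mul _ (hm1 x)).symm
    simp_rw [this]
    rw [lintegral_lintegral_swap]
    · rfl
    · exact (((hm2 θ).comp measurable_fst).mul (hm.comp measurable_swap)).aemeasurable
  rw [e1]
  set T : ℕ → ℝ≥0∞ := fun m => killIter r m (fun y => ENNReal.ofReal (Real.exp (-y))) a
  have e2 : ∀ θ ∈ Set.Icc (0 : ℝ) 1, ∫⁻ θ' in Set.Icc (0 : ℝ) 1, twoPoint r a N θ θ' ≤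
      ENNReal.ofReal (442368 * Real.exp 5 * Real.exp (2 * a)) := by
    intro θ hθ
    calc _ ≤ ∫⁻ θ' in Set.Icc (0 : ℝ) 1, ∑ m ∈ Finset.range (N + 1),
          (Metric.closedBall θ (64 / 2 ^ m)).indicator 1 θ' * (ENNReal.ofReal (Real.exp 5) *
            (ENNReal.ofReal (54 * Real.exp (2 * a) * 2 ^ m) * T m)) := by
          refine setLIntegral_mono' measurableSet_Icc fun θ' hθ' =>
            twoPoint_le_sum hr hr1 hN ha ?_
          rw [abs_le]
          constructor <;> linarith [hθ.1, hθ.2, hθ'.1, hθ'.2]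
      _ ≤ ∫⁻ θ', ∑ m ∈ Finset.range (N + 1),
          (Metric.closedBall θ (64 / 2 ^ m)).indicator 1 θ' * (ENNReal.ofReal (Real.exp 5) *
            (ENNReal.ofReal (54 * Real.exp (2 * a) * 2 ^ m) * T m)) := setLIntegral_le_lintegral _ _
      _ = ∑ m ∈ Finset.range (N + 1), ENNReal.ofReal (6912 * Real.exp 5 * Real.exp (2 * a)) *
            T m := by
          rw [lintegral_finsetSum]
          swap
          · intro m _
            exact (Measurable.indicator measurable_one
              Metric.isClosed_closedBall.measurableSet).mul_const _
          refine Finset.sum_congr rfl fun m _ => ?_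
          rw [lintegral_mul_const _ (Measurable.indicator measurable_one
              Metric.isClosed_closedBall.measurableSet), lintegral_indicator_one
              Metric.isClosed_closedBall.measurableSet, Real.volume_closedBall, ← mul_assoc,
            ← mul_assoc, ← ENNReal.ofReal_mul (by positivity), ← ENNReal.ofReal_mul (by positivity)]
          congr 2
          field_simp
          norm_num
      _ ≤ ENNReal.ofReal (6912 * Real.exp 5 * Real.exp (2 * a)) * 64 := by
          rw [← Finset.mul_sum]
          exact mul_le_mul' le_rfl (sum_killIter_exp_le hr hr1 hN ha)
      _ = _ := by
          rw [← ENNReal.ofReal_ofNat 64, ← ENNReal.ofReal_mul (by positivity)]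
          congr 1
          ring
  refine (setLIntegral_mono' measurableSet_Icc e2).trans (le_of_eq ?_)
  rw [setLIntegral_const, Real.volume_Icc]
  simp

theorem lintegral_sq_mass_le {r a : ℝ} (hr : 0 < r) (hr1 : r ≤ 1) {N : ℕ} (hN1 : 1 ≤ N)
    (hN : -Real.log r * 2 ^ N ≤ 1 / 4) (ha : 1 ≤ a) :
    ∫⁻ x, mass r a N x ^ 2 ∂gaussSeq ≤
      ENNReal.ofReal (442368 * Real.exp 5 * Real.exp (2 * a) * (a / Real.sqrt N) ^ 2) := by
  have hs : 0 < Real.sqrt N := Real.sqrt_pos.2 (by exact_mod_cast hN1)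
  set K := ENNReal.ofReal (Real.sqrt N)⁻¹ with hK
  calc _ ≤ ∫⁻ x, K * K * (derivMass r a N x * derivMass r a N x) ∂gaussSeq := by
        refine lintegral_mono fun x => ?_
        rw [sq]
        refine (mul_le_mul' (mass_le_derivMass hN1 x) (mass_le_derivMass hN1 x)).trans
          (le_of_eq ?_)
        ring
    _ = K * K * ∫⁻ x, derivMass r a N x * derivMass r a N x ∂gaussSeq :=
        lintegral_const_mul' _ _ (ENNReal.mul_ne_top ENNReal.ofReal_ne_top ENNReal.ofReal_ne_top)
    _ ≤ _ := mul_le_mul' le_rfl (lintegral_sq_derivMass_le hr hr1 hN (by linarith))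
    _ ≤ _ := by
        rw [hK, ← ENNReal.ofReal_mul (by positivity), ← ENNReal.ofReal_mul (by positivity)]
        refine ENNReal.ofReal_le_ofReal ?_
        rw [mul_comm]
        refine mul_le_mul_of_nonneg_left ?_ (by positivity)
        rw [← sq]
        refine pow_le_pow_left₀ (by positivity) ?_ 2
        rw [div_eq_mul_inv]
        -- The factor `a ≥ 1` is inserted so that both moments are expressed in `t = a / √N`.
        exact le_mul_of_one_le_left (by positivity) ha

/-- Hölder's inequality between the moments of orders `q`, `1` and `2`. -/
theorem lintegral_rpow_le_of_moments {Ω : Type*} [MeasurableSpace Ω] {μ : Measure Ω} {Y : Ω → ℝ≥0∞}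
    (hY : Measurable Y) {q : ℝ} (hq0 : 0 < q) (hq1 : q ≤ 1) :
    (∫⁻ x, Y x ∂μ) ^ (2 - q) ≤ (∫⁻ x, Y x ^ q ∂μ) * (∫⁻ x, Y x ^ 2 ∂μ) ^ (1 - q) := by
  have h2 : 0 < 2 - q := by linarith
  have h := ENNReal.lintegral_mul_norm_pow_le (μ := μ) (f := fun x => Y x ^ q)
    (g := fun x => Y x ^ 2) (by fun_prop) (by fun_prop) (p := 1 / (2 - q))
    (q := (1 - q) / (2 - q)) (by positivity) (div_nonneg (by linarith) h2.le)
    (by field_simp; ring)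
  have e : ∀ x, (Y x ^ q) ^ (1 / (2 - q)) * (Y x ^ 2) ^ ((1 - q) / (2 - q)) = Y x := by
    intro x
    rw [← ENNReal.rpow_natCast, ← ENNReal.rpow_mul, ← ENNReal.rpow_mul,
      ← ENNReal.rpow_add_of_nonneg _ _ (by positivity)
        (mul_nonneg (by positivity) (div_nonneg (by linarith) h2.le))]
    have : q * (1 / (2 - q)) + ((2 : ℕ) : ℝ) * ((1 - q) / (2 - q)) = 1 := by
      push_cast
      field_simp
      ring
    rw [this, ENNReal.rpow_one]
  simp_rw [e] at h
  have h3 := ENNReal.rpow_le_rpow h h2.le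
  rw [ENNReal.mul_rpow_of_nonneg _ _ h2.le, ← ENNReal.rpow_mul, ← ENNReal.rpow_mul,
    div_mul_cancel₀ _ h2.ne', div_mul_cancel₀ _ h2.ne', ENNReal.rpow_one] at h3
  exact h3

/-- The constant in the lower bound for the moments of the truncated mass. -/
noncomputable def massConst : ℝ := Real.exp (-34) / (442368 * Real.exp 5)

theorem massConst_pos : 0 < massConst := by
  unfold massConst; positivity

/-- In the Hölder quotient the powers of `t` combine to `(2 - q) - 2(1 - q) = q`. The condition
`haq` keeps the loss `exp (2a(1 - q))` below `exp 2`, and `exp (-16(2 - q)) ≥ exp (-32)`. -/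
theorem le_lintegral_mass_rpow {r a q : ℝ} (hr : 0 < r) (hr1 : r ≤ 1) {N : ℕ} (hN1 : 1 ≤ N)
    (hN : -Real.log r * 2 ^ N ≤ 1 / 4) (ha : 1 ≤ a) (haN : a ≤ Real.sqrt N)
    (hq0 : 0 < q) (hq1 : q ≤ 1) (haq : a * (1 - q) ≤ 1) :
    ENNReal.ofReal (massConst * (a / Real.sqrt N) ^ q) ≤ ∫⁻ x, mass r a N x ^ q ∂gaussSeq := by
  have hs : 0 < Real.sqrt N := Real.sqrt_pos.2 (by exact_mod_cast hN1)
  set t := a / Real.sqrt N with ht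
  have ht0 : 0 < t := by positivity
  set C : ℝ := 442368 * Real.exp 5 with hC
  have hC1 : 1 ≤ C := by
    have := Real.one_le_exp (show (0 : ℝ) ≤ 5 by norm_num)
    rw [hC]; linarith
  set B : ℝ := C * Real.exp (2 * a) * t ^ 2 with hB
  have hB0 : 0 < B := by positivity
  have h := lintegral_rpow_le_of_moments (μ := gaussSeq) (measurable_mass r a N) hq0 hq1
  have h1 := ENNReal.rpow_le_rpow (le_lintegral_mass hr hr1 hN1 hN (by linarith) haN)
    (show 0 ≤ 2 - q by linarith)
  have h2 := ENNReal.rpow_le_rpow (lintegral_sq_mass_le hr hr1 hN1 hN ha)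
    (show 0 ≤ 1 - q by linarith)
  have h3 := h1.trans (h.trans (mul_le_mul' le_rfl h2))
  rw [← ht, ← hC, ← hB, ENNReal.ofReal_rpow_of_pos (by positivity),
    ENNReal.ofReal_rpow_of_pos hB0] at h3
  have hBq : 0 < B ^ (1 - q) := Real.rpow_pos_of_pos hB0 _
  rw [← ENNReal.div_le_iff (by simpa using hBq) ENNReal.ofReal_ne_top,
    ← ENNReal.ofReal_div_of_pos hBq] at h3
  refine le_trans (ENNReal.ofReal_le_ofReal ?_) h3
  rw [le_div_iff₀ hBq, hB, Real.mul_rpow (by positivity) (by positivity),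
    Real.mul_rpow (by positivity) (by positivity), Real.mul_rpow (by positivity) ht0.le,
    ← Real.exp_mul, ← Real.exp_mul, ← Real.rpow_natCast, ← Real.rpow_mul ht0.le]
  have e1 : t ^ (2 - q) = t ^ q * t ^ (((2 : ℕ) : ℝ) * (1 - q)) := by
    rw [← Real.rpow_add ht0]; congr 1; push_cast; ring
  have e2 : C ^ (1 - q) ≤ C := by
    calc C ^ (1 - q) ≤ C ^ (1 : ℝ) := Real.rpow_le_rpow_of_exponent_le hC1 (by linarith)
      _ = C := Real.rpow_one C
  have e3 : Real.exp (2 * a * (1 - q)) ≤ Real.exp 2 := Real.exp_le_exp.2 (by linarith)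
  have e4 : Real.exp (-32) ≤ Real.exp (-16 * (2 - q)) := Real.exp_le_exp.2 (by linarith)
  have e5 : massConst * (C * Real.exp 2) = Real.exp (-32) := by
    unfold massConst
    rw [← hC, div_mul_eq_mul_div, mul_left_comm, mul_div_assoc, ← Real.exp_add]
    rw [show (-34 : ℝ) + 2 = -32 by norm_num]
    field_simp
  rw [e1]
  have hp : 0 < t ^ q * t ^ (((2 : ℕ) : ℝ) * (1 - q)) := by positivity
  calc _ = massConst * (C ^ (1 - q) * Real.exp (2 * a * (1 - q))) *
        (t ^ q * t ^ (((2 : ℕ) : ℝ) * (1 - q))) := by ring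
    _ ≤ massConst * (C * Real.exp 2) * (t ^ q * t ^ (((2 : ℕ) : ℝ) * (1 - q))) := by
        have := massConst_pos
        gcongr
    _ ≤ _ := by
        rw [e5]
        gcongr

/-! ### The total mass and its moments -/

/-- The integral over the circle of the squared modulus of the exponential of the partial sum over
the indices in `S`. -/
noncomputable def circleMass (r : ℝ) (S : Finset ℕ) (x : ℕ → ℂ) : ℝ≥0∞ :=
  ∫⁻ θ in Set.Ioc 0 (2 * Real.pi), ENNReal.ofReal (Real.exp (2 * linForm S (coef r θ) x))

theorem measurable_linForm_coef (r : ℝ) (S : Finset ℕ) :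
    Measurable fun p : ℝ × (ℕ → ℂ) => linForm S (coef r p.1) p.2 := by
  unfold linForm
  refine Finset.measurable_sum _ fun k _ => ?_
  have := measurable_coef r k
  fun_prop

theorem measurable_exp_linForm_coef (r : ℝ) (S : Finset ℕ) :
    Measurable fun p : ℝ × (ℕ → ℂ) =>
      ENNReal.ofReal (Real.exp (2 * linForm S (coef r p.1) p.2)) := by
  have := measurable_linForm_coef r S
  fun_prop

theorem measurable_linForm_coef_left (r : ℝ) (S : Finset ℕ) (x : ℕ → ℂ) :
    Measurable fun θ => linForm S (coef r θ) x := by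
  unfold linForm
  refine Finset.measurable_sum _ fun k _ => ?_
  have := measurable_coef r k
  fun_prop

theorem measurable_exp_linForm_coef_left (r : ℝ) (S : Finset ℕ) (x : ℕ → ℂ) :
    Measurable fun θ => ENNReal.ofReal (Real.exp (2 * linForm S (coef r θ) x)) := by
  have := measurable_linForm_coef_left r S x
  fun_prop

theorem measurable_circleMass (r : ℝ) (S : Finset ℕ) : Measurable (circleMass r S) :=
  (measurable_exp_linForm_coef r S).lintegral_prod_left'

theorem lintegral_circleMass_lt_top {r : ℝ} (hr : 0 ≤ r) (S : Finset ℕ) :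
    ∫⁻ x, circleMass r S x ∂gaussSeq < ∞ := by
  unfold circleMass
  rw [lintegral_lintegral_swap]
  swap
  · exact ((measurable_exp_linForm_coef r S).comp measurable_swap).aemeasurable
  have h : ∀ θ, ∫⁻ x, ENNReal.ofReal (Real.exp (2 * linForm S (coef r θ) x)) ∂gaussSeq =
      ENNReal.ofReal (Real.exp (2 ^ 2 * varForm S (coef r 0) / 2)) := by
    intro θ
    rw [← lintegral_map (f := fun g => ENNReal.ofReal (Real.exp (2 * g))) (by fun_prop)
      (measurable_linForm S (coef r θ)), map_linForm]
    have h2 := lintegral_exp_mul_gaussianReal (varForm S (coef r θ)) 2 (fun _ => 1)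
      measurable_const
    simp only [mul_one, lintegral_one, measure_univ] at h2
    rw [h2, coe_varForm_coef hr, coe_varForm_coef hr]
  simp_rw [h]
  rw [setLIntegral_const, Real.volume_Ioc]
  exact ENNReal.mul_lt_top ENNReal.ofReal_lt_top ENNReal.ofReal_lt_top

/-- Finiteness lets bounds on the lower integral pass to the Bochner integral, whose default value
would otherwise be zero. -/
theorem lintegral_circleMass_rpow_lt_top {r q : ℝ} (hr : 0 ≤ r) (hq0 : 0 ≤ q) (hq1 : q ≤ 1)
    (S : Finset ℕ) : ∫⁻ x, circleMass r S x ^ q ∂gaussSeq < ∞ := by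
  have h : ∀ y : ℝ≥0∞, y ^ q ≤ 1 + y := by
    intro y
    rcases le_total y 1 with h | h
    · exact (ENNReal.rpow_le_one h hq0).trans le_self_add
    · calc y ^ q ≤ y ^ (1 : ℝ) := ENNReal.rpow_le_rpow_of_exponent_le h hq1
        _ = y := ENNReal.rpow_one y
        _ ≤ _ := le_add_self
  refine (lintegral_mono fun x => h (circleMass r S x)).trans_lt ?_
  rw [lintegral_add_left measurable_const, lintegral_one, measure_univ]
  exact ENNReal.add_lt_top.2 ⟨ENNReal.one_lt_top, lintegral_circleMass_lt_top hr S⟩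

theorem map_neg_stdComplexGaussian :
    stdComplexGaussian.map (fun z => -z) = stdComplexGaussian := by
  have hn : (gaussianReal 0 (1 / 2)).map (fun x => -x) = gaussianReal 0 (1 / 2) := by
    rw [gaussianReal_map_neg, neg_zero]
  have h := Measure.map_prod_map (gaussianReal 0 (1 / 2)) (gaussianReal 0 (1 / 2))
    (f := fun x : ℝ => -x) (g := fun x : ℝ => -x) (by fun_prop) (by fun_prop)
  rw [hn] at h
  have hs := Complex.measurableEquivRealProd.symm.measurable
  unfold stdComplexGaussian
  conv_rhs => rw [h]
  rw [Measure.map_map (by fun_prop) hs, Measure.map_map hs (by fun_prop)]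
  congr 1

/-- Change of sign of the coordinates in `T`. -/
def signFlip (T : Finset ℕ) (x : ℕ → ℂ) (k : ℕ) : ℂ := if k ∈ T then -x k else x k

theorem measurable_signFlip (T : Finset ℕ) : Measurable (signFlip T) := by
  refine measurable_pi_lambda _ fun k => ?_
  unfold signFlip
  split_ifs <;> fun_prop

theorem map_signFlip (T : Finset ℕ) : gaussSeq.map (signFlip T) = gaussSeq := by
  have h := Measure.infinitePi_map_pi (μ := fun _ : ℕ => stdComplexGaussian)
    (f := fun k z => if k ∈ T then -z else z) (fun k => by split_ifs <;> fun_prop)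
  have e : (fun (k : ℕ) => stdComplexGaussian.map (fun z => if k ∈ T then -z else z)) =
      fun _ => stdComplexGaussian := by
    funext k
    split_ifs with hk
    · exact map_neg_stdComplexGaussian
    · exact Measure.map_id
  exact h.trans (congrArg Measure.infinitePi e)


theorem linForm_add_signFlip {S S' : Finset ℕ} (h : S ⊆ S') (b x : ℕ → ℂ) :
    linForm S' b x + linForm S' b (signFlip (S' \ S) x) = 2 * linForm S b x := by
  unfold linForm
  rw [← Finset.sum_add_distrib, ← Finset.sum_sdiff h, Finset.mul_sum]
  have h1 : ∑ k ∈ S' \ S, ((x k * b k).re + (signFlip (S' \ S) x k * b k).re) = 0 := by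
    refine Finset.sum_eq_zero fun k hk => ?_
    rw [signFlip, if_pos hk, neg_mul, Complex.neg_re, add_neg_cancel]
  rw [h1, zero_add]
  refine Finset.sum_congr rfl fun k hk => ?_
  rw [signFlip, if_neg (by simp [hk])]
  ring

/-- Adding independent symmetric terms to the exponent increases the moments of the mass. -/
theorem lintegral_circleMass_rpow_mono {r q : ℝ} (hq0 : 0 ≤ q) {S S' : Finset ℕ} (h : S ⊆ S') :
    ∫⁻ x, circleMass r S x ^ q ∂gaussSeq ≤ ∫⁻ x, circleMass r S' x ^ q ∂gaussSeq := by
  have hf := measurable_signFlip (S' \ S)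
  have hm := measurable_circleMass r S'
  have hmeas := measurable_exp_linForm_coef_left r
  -- Flipping the signs on `S' \ S` makes the integrand for `S` the geometric mean of two integrands
  -- for `S'`. Cauchy–Schwarz in the angle, then in probability, suffices because the flip preserves
  -- the law.
  have h1 : ∀ x, circleMass r S x ≤ circleMass r S' x ^ (1 / 2 : ℝ) *
      circleMass r S' (signFlip (S' \ S) x) ^ (1 / 2 : ℝ) := by
    intro x
    refine le_trans (le_of_eq ?_) (ENNReal.lintegral_mul_norm_pow_le (hmeas S' x).aemeasurable
      (hmeas S' (signFlip (S' \ S) x)).aemeasurable (p := 1 / 2) (q := 1 / 2) (by norm_num)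
      (by norm_num) (by norm_num))
    refine lintegral_congr fun θ => ?_
    rw [← ENNReal.mul_rpow_of_nonneg _ _ (by norm_num), ← ENNReal.ofReal_mul (by positivity),
      ← Real.exp_add, ← mul_add, linForm_add_signFlip h,
      ENNReal.ofReal_rpow_of_pos (Real.exp_pos _), ← Real.exp_mul]
    congr 2
    ring
  have h2 : ∀ x, circleMass r S x ^ q ≤ (circleMass r S' x ^ q) ^ (1 / 2 : ℝ) *
      (circleMass r S' (signFlip (S' \ S) x) ^ q) ^ (1 / 2 : ℝ) := by
    intro x
    refine (ENNReal.rpow_le_rpow (h1 x) hq0).trans (le_of_eq ?_)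
    rw [ENNReal.mul_rpow_of_nonneg _ _ hq0]
    rw [← ENNReal.rpow_mul, ← ENNReal.rpow_mul, ← ENNReal.rpow_mul, ← ENNReal.rpow_mul,
      mul_comm q]
  have h3 : ∫⁻ x, circleMass r S' (signFlip (S' \ S) x) ^ q ∂gaussSeq =
      ∫⁻ x, circleMass r S' x ^ q ∂gaussSeq := by
    conv_rhs => rw [← map_signFlip (S' \ S)]
    rw [lintegral_map (hm.pow_const q) hf]
  have hm1 : Measurable fun x => circleMass r S' x ^ q := hm.pow_const q
  have hm2 : Measurable fun x => circleMass r S' (signFlip (S' \ S) x) ^ q := hm1.comp hf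
  refine (lintegral_mono h2).trans ((ENNReal.lintegral_mul_norm_pow_le
    hm1.aemeasurable hm2.aemeasurable (p := 1 / 2) (q := 1 / 2) (by norm_num) (by norm_num) (by norm_num)).trans ?_)
  rw [h3, ← ENNReal.rpow_add_of_nonneg _ _ (by norm_num) (by norm_num)]
  norm_num

theorem pos_eq (r a : ℝ) (m : ℕ) (θ : ℝ) (x : ℕ → ℂ) :
    pos r a m θ x = a + logSecond r m - linForm (Finset.Ico 1 (2 ^ m)) (coef r θ) x := by
  induction m with
  | zero => simp [pos, logSecond, linForm]
  | succ m ih =>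
    have e : linForm (Finset.Ico 1 (2 ^ (m + 1))) (coef r θ) x =
        linForm (Finset.Ico 1 (2 ^ m)) (coef r θ) x + blockSum r m θ x :=
      (Finset.sum_Ico_consecutive _ (Nat.one_le_two_pow (n := m))
        (Nat.pow_le_pow_right (by norm_num) (Nat.le_add_right m 1))).symm
    rw [pos, ih, e, logSecond, logSecond, Finset.sum_range_succ]
    ring

theorem mass_le_circleMass (r a : ℝ) (N : ℕ) (x : ℕ → ℂ) :
    ENNReal.ofReal (Real.exp (logSecond r N)) * mass r a N x ≤
      circleMass r (Finset.Ico 1 (2 ^ N)) x := by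
  rw [mass, ← lintegral_const_mul' _ _ ENNReal.ofReal_ne_top,
    setLIntegral_congr Ioc_ae_eq_Icc.symm]
  refine (lintegral_mono fun θ => ?_).trans (lintegral_mono_set (Set.Ioc_subset_Ioc_right
    (by linarith [Real.pi_gt_three])))
  have h1 : (Set.Ici (Real.sqrt N)).indicator (1 : ℝ → ℝ≥0∞) (pos r a N θ x) ≤ 1 :=
    Set.indicator_le_self' (fun _ _ => zero_le) _
  refine (mul_le_mul' le_rfl (mul_le_mul' (wt_le r a N θ x) h1)).trans (le_of_eq ?_)
  rw [mul_one, ← ENNReal.ofReal_mul (by positivity), ← Real.exp_add, pos_eq]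
  congr 2
  ring

theorem le_lintegral_circleMass_rpow {r a q : ℝ} (hr : 0 < r) (hr1 : r ≤ 1) {N : ℕ} (hN1 : 1 ≤ N)
    (hN : -Real.log r * 2 ^ N ≤ 1 / 4) (ha : 1 ≤ a) (haN : a ≤ Real.sqrt N)
    (hq0 : 0 < q) (hq1 : q ≤ 1) (haq : a * (1 - q) ≤ 1) {S : Finset ℕ}
    (hS : Finset.Ico 1 (2 ^ N) ⊆ S) :
    ENNReal.ofReal (massConst * (2 ^ N / 2 * (a / Real.sqrt N)) ^ q) ≤
      ∫⁻ x, circleMass r S x ^ q ∂gaussSeq := by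
  have hE := Real.exp_pos (logSecond r N)
  calc _ ≤ ENNReal.ofReal (Real.exp (logSecond r N)) ^ q *
        ENNReal.ofReal (massConst * (a / Real.sqrt N) ^ q) := by
        rw [ENNReal.ofReal_rpow_of_pos hE, ← ENNReal.ofReal_mul (by positivity)]
        refine ENNReal.ofReal_le_ofReal ?_
        rw [Real.mul_rpow (by positivity) (by positivity), mul_left_comm]
        have := massConst_pos
        have h1 : ((2 : ℝ) ^ N / 2) ^ q ≤ Real.exp (logSecond r N) ^ q :=
          Real.rpow_le_rpow (by positivity) (le_exp_logSecond hr hN hr1) hq0.le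
        exact mul_le_mul_of_nonneg_right h1 (by positivity)
    _ ≤ ENNReal.ofReal (Real.exp (logSecond r N)) ^ q * ∫⁻ x, mass r a N x ^ q ∂gaussSeq :=
        mul_le_mul' le_rfl (le_lintegral_mass_rpow hr hr1 hN1 hN ha haN hq0 hq1 haq)
    _ ≤ ∫⁻ x, circleMass r (Finset.Ico 1 (2 ^ N)) x ^ q ∂gaussSeq := by
        rw [← lintegral_const_mul' _ _ (ENNReal.rpow_ne_top_of_nonneg hq0.le ENNReal.ofReal_ne_top)]
        refine lintegral_mono fun x => ?_
        rw [← ENNReal.mul_rpow_of_nonneg _ _ hq0.le]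
        exact ENNReal.rpow_le_rpow (mass_le_circleMass r a N x) hq0.le
    _ ≤ _ := lintegral_circleMass_rpow_mono hq0.le hS

/-! ### Transfer to an arbitrary Gaussian sequence -/

/-- The shift removes the unconstrained entry `X 0` and matches the indexing of `gaussSeq` from
zero. -/
theorem hasLaw_shift {Ω : Type*} [MeasurableSpace Ω] {P : Measure Ω} {X : ℕ → Ω → ℂ}
    (hX : IsStdComplexGaussianSeq P X) : HasLaw (fun ω k => X (k + 1) ω) gaussSeq P :=
  hX.indep.hasLaw_infinitePi (fun k => hX.law (k + 1) (Nat.le_add_left 1 k))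
    (aemeasurable_pi_lambda _ fun k => (hX.law (k + 1) (Nat.le_add_left 1 k)).aemeasurable)

/-- Shift of a sequence to the right. -/
def shiftRight (w : ℕ → ℂ) : ℕ → ℂ
  | 0 => 0
  | k + 1 => w k

theorem measurable_shiftRight : Measurable shiftRight := by
  refine measurable_pi_lambda _ fun k => ?_
  cases k with
  | zero => exact measurable_const
  | succ k => exact measurable_pi_apply k

theorem circleMass_shiftRight (r : ℝ) (n : ℕ) (x : ℕ → ℂ) :
    circleMass r (Finset.Icc 1 n) (shiftRight fun k => x (k + 1)) =
      circleMass r (Finset.Icc 1 n) x := by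
  unfold circleMass linForm
  refine lintegral_congr fun θ => ?_
  congr 3
  refine Finset.sum_congr rfl fun k hk => ?_
  obtain ⟨j, rfl⟩ : ∃ j, k = j + 1 := ⟨k - 1, by have := (Finset.mem_Icc.1 hk).1; omega⟩
  rfl

theorem isStdComplexGaussianSeq_gaussSeq :
    IsStdComplexGaussianSeq gaussSeq fun (k : ℕ) (x : ℕ → ℂ) => x k where
  indep := by
    have hI : iIndepFun (fun (k : ℕ) (x : ℕ → ℂ) => x k) gaussSeq :=
      iIndepFun_infinitePi (P := fun _ : ℕ => stdComplexGaussian) (X := fun _ => id)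
        (fun _ => measurable_id)
    exact hI.precomp (add_left_injective 1)
  law k _ :=
    { aemeasurable := (measurable_pi_apply k).aemeasurable
      map_eq := Measure.infinitePi_map_eval (fun _ : ℕ => stdComplexGaussian) k }

/-- After the shift both sequences have law `gaussSeq`, and the functional ignores the entry of
index zero. -/
theorem lintegral_circleMass_eq {Ω : Type*} [MeasurableSpace Ω] {P : Measure Ω} {X : ℕ → Ω → ℂ}
    (hX : IsStdComplexGaussianSeq P X) (r q : ℝ) (n : ℕ) :
    ∫⁻ ω, circleMass r (Finset.Icc 1 n) (fun k => X k ω) ^ q ∂P =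
      ∫⁻ x, circleMass r (Finset.Icc 1 n) x ^ q ∂gaussSeq := by
  have hm : Measurable fun w => circleMass r (Finset.Icc 1 n) (shiftRight w) ^ q :=
    ((measurable_circleMass r _).comp measurable_shiftRight).pow_const q
  have h1 := (hasLaw_shift hX).lintegral_comp hm.aemeasurable
  have h2 := (hasLaw_shift isStdComplexGaussianSeq_gaussSeq).lintegral_comp hm.aemeasurable
  rw [← h1] at h2
  refine Eq.trans (lintegral_congr fun ω => ?_) (h2.symm.trans (lintegral_congr fun x => ?_))
  · exact congrArg (· ^ q) (circleMass_shiftRight r n fun k => X k ω).symm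
  · exact congrArg (· ^ q) (circleMass_shiftRight r n x)

theorem norm_sq_F {Ω : Type*} (X : ℕ → Ω → ℂ) (K : ℝ) (ω : Ω) (r θ : ℝ) :
    ‖F X K ω ((r : ℂ) * Complex.exp ((θ : ℂ) * Complex.I))‖ ^ 2 =
      Real.exp (2 * linForm (Finset.Icc 1 ⌊K⌋₊) (coef r θ) fun k => X k ω) := by
  rw [F, Complex.norm_exp, ← Real.exp_nat_mul, Complex.re_sum, linForm, Nat.cast_ofNat]
  congr 2
  refine Finset.sum_congr rfl fun k _ => ?_
  rw [coef, div_mul_eq_mul_div, mul_div_assoc]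

theorem integral_norm_sq_F {Ω : Type*} (X : ℕ → Ω → ℂ) (K : ℝ) (ω : Ω) (r : ℝ) :
    ∫ θ in (0 : ℝ)..(2 * Real.pi),
        ‖F X K ω ((r : ℂ) * Complex.exp ((θ : ℂ) * Complex.I))‖ ^ 2 =
      (circleMass r (Finset.Icc 1 ⌊K⌋₊) fun k => X k ω).toReal := by
  rw [intervalIntegral.integral_of_le (by positivity)]
  simp_rw [norm_sq_F]
  rw [integral_eq_lintegral_of_nonneg_ae (ae_of_all _ fun θ => (Real.exp_pos _).le)]
  · rfl
  · have h := measurable_linForm_coef_left r (Finset.Icc 1 ⌊K⌋₊) fun k => X k ω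
    exact Measurable.aestronglyMeasurable (by fun_prop)

/-- The moments of the integral of `|F| ^ 2` do not depend on the underlying probability space. -/
theorem integral_rpow_eq {Ω : Type*} [MeasurableSpace Ω] {P : Measure Ω} {X : ℕ → Ω → ℂ}
    (hX : IsStdComplexGaussianSeq P X) (K : ℝ) {r q : ℝ} (hr : 0 ≤ r) (hq0 : 0 ≤ q)
    (hq1 : q ≤ 1) :
    ∫ ω, (∫ θ in (0 : ℝ)..(2 * Real.pi),
        ‖F X K ω ((r : ℂ) * Complex.exp ((θ : ℂ) * Complex.I))‖ ^ 2) ^ q ∂P =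
      (∫⁻ x, circleMass r (Finset.Icc 1 ⌊K⌋₊) x ^ q ∂gaussSeq).toReal := by
  have hfin := lintegral_circleMass_rpow_lt_top hr hq0 hq1 (Finset.Icc 1 ⌊K⌋₊)
  rw [← lintegral_circleMass_eq hX] at hfin ⊢
  have hm : AEMeasurable (fun ω => circleMass r (Finset.Icc 1 ⌊K⌋₊) (fun k => X k ω) ^ q) P := by
    have hm1 : Measurable fun w => circleMass r (Finset.Icc 1 ⌊K⌋₊) (shiftRight w) ^ q :=
      ((measurable_circleMass r _).comp measurable_shiftRight).pow_const q
    refine (hm1.comp_aemeasurable (hasLaw_shift hX).aemeasurable).congr (ae_of_all _ fun ω => ?_)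
    exact congrArg (· ^ q) (circleMass_shiftRight r _ fun k => X k ω)
  rw [← integral_toReal hm (ae_lt_top' hm hfin.ne)]
  simp_rw [integral_norm_sq_F, ENNReal.toReal_rpow]

/-! ### Choice of the dyadic scale and of the barrier -/

/-- `2 ^ N` is the largest power of two not exceeding `K_r`. The square root bound follows from `N
log 2 ≤ log K_r` and `log 2 ≥ 1/4`. -/
theorem exists_dyadic_scale {K r : ℝ} (hK : 10 ≤ K) (hr : Real.exp (-1 / 40) ≤ r) (hr1 : r < 1) :
    ∃ N : ℕ, 1 ≤ N ∧ -Real.log r * 2 ^ N ≤ 1 / 4 ∧ (2 : ℝ) ^ N ≤ K ∧ Kr K r ≤ 2 * 2 ^ N ∧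
      Real.sqrt N ≤ 2 * Real.sqrt (logKr K r) := by
  have hr0 : 0 < r := (Real.exp_pos _).trans_le hr
  have hlog : Real.log r < 0 := Real.log_neg hr0 hr1
  have hlog2 : -1 / 40 ≤ Real.log r := (Real.le_log_iff_exp_le hr0).2 hr
  have hg := isGreatest_logKr (K := K) (by linarith) hr0 hr1
  -- Both entries of the minimum are at least `10 ≥ exp 2`: this is where `K ≥ 10` and `r ≥ exp
  -- (-1/40)` enter.
  have hn2 : 2 ≤ logKr K r := by
    refine hg.2 ?_
    have h10 : Real.exp ((2 : ℤ) : ℝ) ≤ 10 := by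
      have e : Real.exp ((2 : ℤ) : ℝ) = Real.exp 1 ^ 2 := by
        rw [← Real.exp_nat_mul]; norm_num
      rw [e]
      have := Real.exp_one_lt_d9
      have := Real.exp_pos 1
      nlinarith
    refine le_min (h10.trans ?_) (h10.trans hK)
    rw [le_div_iff_of_neg (by linarith)]
    linarith
  have hmem : Kr K r ≤ min (-1 / (4 * Real.log r)) K := hg.1
  have hn2' : (2 : ℝ) ≤ logKr K r := by exact_mod_cast hn2
  have hKr3 : 3 ≤ Kr K r := by
    have := Real.add_one_le_exp (logKr K r : ℝ)
    unfold Kr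
    linarith
  have hfl : ⌊Kr K r⌋₊ ≠ 0 := by
    have : 2 ≤ ⌊Kr K r⌋₊ := Nat.le_floor (by push_cast; linarith)
    omega
  refine ⟨Nat.log 2 ⌊Kr K r⌋₊, ?_⟩
  set N := Nat.log 2 ⌊Kr K r⌋₊ with hN
  have hlow : (2 : ℝ) ^ N ≤ Kr K r := by
    have h1 : 2 ^ N ≤ ⌊Kr K r⌋₊ := Nat.pow_log_le_self 2 hfl
    calc (2 : ℝ) ^ N = ((2 ^ N : ℕ) : ℝ) := by push_cast; rfl
      _ ≤ ⌊Kr K r⌋₊ := by exact_mod_cast h1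
      _ ≤ Kr K r := Nat.floor_le (by linarith)
  refine ⟨?_, ?_, ?_, ?_, ?_⟩
  · exact Nat.log_pos (by norm_num) (Nat.le_floor (by push_cast; linarith))
  · have h1 : Kr K r ≤ -1 / (4 * Real.log r) := hmem.trans (min_le_left _ _)
    rw [le_div_iff_of_neg (by linarith)] at h1
    nlinarith
  · exact hlow.trans (hmem.trans (min_le_right _ _))
  · have h1 : ⌊Kr K r⌋₊ + 1 ≤ 2 ^ (N + 1) := Nat.lt_pow_succ_log_self (by norm_num) _
    have h2 := (Nat.lt_floor_add_one (Kr K r)).le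
    have h3 : ((⌊Kr K r⌋₊ : ℝ) + 1) ≤ 2 ^ (N + 1) := by exact_mod_cast h1
    rw [pow_succ] at h3
    linarith
  · have h1 : (N : ℝ) * Real.log 2 ≤ logKr K r := by
      have h2 : Real.log (2 ^ N) ≤ Real.log (Kr K r) := Real.log_le_log (by positivity) hlow
      rwa [Real.log_pow, Kr, Real.log_exp] at h2
    have hl2 := Real.log_two_gt_d9
    have hN0 : (0 : ℝ) ≤ N := Nat.cast_nonneg N
    have h3 : (N : ℝ) ≤ 2 ^ 2 * logKr K r := by nlinarith
    calc Real.sqrt N ≤ Real.sqrt (2 ^ 2 * logKr K r) := Real.sqrt_le_sqrt h3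
      _ = 2 * Real.sqrt (logKr K r) := by
        rw [Real.sqrt_mul (by norm_num), Real.sqrt_sq (by norm_num)]

/-- With `R = √N`, the witness is comparable to `min (R, 1 / (1 - q))`: as high as possible while
the loss `exp (2a(1 - q))` stays bounded. The maximum with `1` secures `a ≥ 1`. -/
theorem exists_barrier {R q : ℝ} (hR : 1 ≤ R) (hq0 : 0 ≤ q) (hq1 : q ≤ 1) :
    ∃ a, 1 ≤ a ∧ a ≤ R ∧ a * (1 - q) ≤ 1 ∧ 1 / ((1 - q) * R + 1) ≤ a / R := by
  have h0 : 0 ≤ (1 - q) * R := mul_nonneg (by linarith) (by linarith)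
  refine ⟨max 1 (R / ((1 - q) * R + 1)), le_max_left _ _, max_le hR ?_, ?_, ?_⟩
  · exact div_le_self (by linarith) (by linarith)
  · rcases le_total (R / ((1 - q) * R + 1)) 1 with h | h
    · rw [max_eq_left h]; linarith
    · rw [max_eq_right h, div_mul_eq_mul_div, div_le_one (by linarith)]
      linarith
  · rw [le_div_iff₀ (by linarith), one_div_mul_eq_div]
    exact le_max_right _ _

end HarperModel

/-! ### Assembly of the estimates. -/

theorem proposition8p2 :
    ∃ C : ℝ, 0 < C ∧
      ∀ (Ω : Type*) [MeasurableSpace Ω] (P : Measure Ω) [IsProbabilityMeasure P]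
        (X : ℕ → Ω → ℂ), HarperModel.IsStdComplexGaussianSeq P X →
      ∀ K q r : ℝ, 10 ≤ K → 1 / 2 ≤ q → q ≤ 1 → Real.exp (-1 / 40) ≤ r → r < 1 →
        C * (HarperModel.Kr K r /
              ((1 - q) * Real.sqrt (HarperModel.logKr K r : ℝ) + 1)) ^ q
          ≤ ∫ ω, (∫ θ in (0 : ℝ)..(2 * Real.pi),
              ‖HarperModel.F X K ω ((r : ℂ) * Complex.exp ((θ : ℂ) * Complex.I))‖ ^ 2) ^ q ∂P := by
  refine ⟨HarperModel.massConst / 8, by linarith [HarperModel.massConst_pos], ?_⟩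
  intro Ω _ P _ X hX K q r hK hq hq1 hr hr1
  have hc := HarperModel.massConst_pos
  have hr0 : 0 < r := (Real.exp_pos _).trans_le hr
  obtain ⟨N, hN1, hN, hNK, hKr, hsq⟩ := HarperModel.exists_dyadic_scale hK hr hr1
  have hR : 1 ≤ Real.sqrt N := Real.one_le_sqrt.2 (by exact_mod_cast hN1)
  obtain ⟨a, ha, haN, haq, haR⟩ := HarperModel.exists_barrier (q := q) hR (by linarith) hq1
  have hS : Finset.Ico 1 (2 ^ N) ⊆ Finset.Icc 1 ⌊K⌋₊ := by
    intro k hk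
    have h1 := Finset.mem_Ico.1 hk
    have h2 : 2 ^ N ≤ ⌊K⌋₊ := Nat.le_floor (by push_cast; exact hNK)
    exact Finset.mem_Icc.2 ⟨h1.1, h1.2.le.trans h2⟩
  have h := HarperModel.le_lintegral_circleMass_rpow hr0 hr1.le hN1 hN ha haN (by linarith) hq1 haq hS
  have hfin := HarperModel.lintegral_circleMass_rpow_lt_top hr0.le (by linarith) hq1
    (Finset.Icc 1 ⌊K⌋₊)
  rw [HarperModel.integral_rpow_eq hX K hr0.le (by linarith) hq1]
  refine le_trans ?_ ((ENNReal.ofReal_le_iff_le_toReal hfin.ne).1 h)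
  set s := Real.sqrt (HarperModel.logKr K r : ℝ)
  have hs : 0 ≤ s := Real.sqrt_nonneg _
  have hKr0 : 0 < HarperModel.Kr K r := Real.exp_pos _
  have hq' : 0 ≤ 1 - q := by linarith
  have hd : 0 < (1 - q) * s + 1 := by positivity
  -- `1/8` collects `K_r ≤ 2 * 2 ^ N`, the half in `2 ^ N / 2`, and `√N ≤ 2√(log K_r)`.
  have hbase : 1 / 8 * (HarperModel.Kr K r / ((1 - q) * s + 1)) ≤
      2 ^ N / 2 * (a / Real.sqrt N) := by
    have h1 : 1 / (2 * ((1 - q) * s + 1)) ≤ a / Real.sqrt N := by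
      refine le_trans (one_div_le_one_div_of_le (by positivity) ?_) haR
      nlinarith [mul_le_mul_of_nonneg_left hsq hq']
    calc _ = HarperModel.Kr K r / 4 * (1 / (2 * ((1 - q) * s + 1))) := by field_simp; norm_num
      _ ≤ _ := mul_le_mul (by linarith) h1 (by positivity) (by positivity)
  -- The constant leaves the `q`-th power uniformly in `q ≤ 1`.
  have h8 : (1 / 8 : ℝ) ≤ (1 / 8 : ℝ) ^ q := by
    calc (1 / 8 : ℝ) = (1 / 8 : ℝ) ^ (1 : ℝ) := (Real.rpow_one _).symm
      _ ≤ _ := Real.rpow_le_rpow_of_exponent_ge (by norm_num) (by norm_num) hq1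
  calc HarperModel.massConst / 8 * (HarperModel.Kr K r / ((1 - q) * s + 1)) ^ q
      = HarperModel.massConst * (1 / 8 * (HarperModel.Kr K r / ((1 - q) * s + 1)) ^ q) := by ring
    _ ≤ HarperModel.massConst *
        ((1 / 8) ^ q * (HarperModel.Kr K r / ((1 - q) * s + 1)) ^ q) := by gcongr
    _ = HarperModel.massConst * (1 / 8 * (HarperModel.Kr K r / ((1 - q) * s + 1))) ^ q := by
        rw [Real.mul_rpow (by norm_num) (by positivity)]
    _ ≤ _ := by gcongr
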